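/- Let $\alpha,\gamma\in(0,1]$, $x\in(0,1)$ and $f_0\in C^\alpha[0,1]$, i.e. $f_0:[0,1]\to\mathbb R$ with $\sup_{s\ne t}|f_0(s)-f_0(t)|/|s-t|^\alpha<\infty$. For each $n$ let $x_i=\frac{i}{n+1/2}$, $i=1,\dots,n$, and observe $y_i=f_0(x_i)+\varepsilon_i$ with $\varepsilon_i$ i.i.d. $N(0,1)$; write $E_{f_0}$ for the expectation over $\mathbf y=(y_1,\dots,y_n)^T$. Take as prior the rescaled Brownian motion $f\sim GP(0,k)$ with covariance kernel $k(s,t)=(n+1/2)^{\frac{1-2\gamma}{1+2\gamma}}\min(s,t)$ on $[0,1]$, and put $\mathbf k_n(s)=(k(s,x_1),\dots,k(s,x_n))^T$ and $\mathbf K_{nn}=(k(x_i,x_j))_{i,j}$. Let $\mathbf v_1,\dots,\mathbf v_n$ be any orthonormal eigenvectors of $\mathbf K_{nn}$, ordered by decreasing eigenvalues. Let $m=m_n\le n$ be integers with $m_n\to\infty$ and take the inducing variables $u_j=\sum_{i=1}^n v_j^i f(x_i)$, $j=1,\dots,m$. The SGPR $Q^*_\gamma=Q^*_\gamma(\cdot\mid\mathbf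 y)$ is the Gaussian process on $[0,1]$ with mean and covariance functions $$\nu_m(s)=\mathbf K_{sm}(\mathbf K_{mm}+\mathbf K_{mn}\mathbf K_{nm})^{-1}\mathbf K_{mn}\mathbf y,$$ $$k_m(s,t)=k(s,t)-\mathbf K_{sm}\mathbf K_{mm}^{-1}\mathbf K_{mt}+\mathbf K_{sm}(\mathbf K_{mm}+\mathbf K_{mn}\mathbf K_{nm})^{-1}\mathbf K_{mt},$$ where, with covariances under the prior, $\mathbf K_{sm}=(\mathrm{cov}(f(s),u_j))_{j}=\mathbf K_{ms}^T$, $\mathbf K_{mm}=(\mathrm{cov}(u_i,u_j))_{i,j}$ and $\mathbf K_{nm}=(\mathrm{cov}(f(x_i),u_j))_{i,j}=\mathbf K_{mn}^T$. The full posterior $\Pi(\cdot\mid\mathbf y)$ is the Gaussian process with mean $\mathbf k_n(s)^T(\mathbf K_{nn}+\mathbf I_n)^{-1}\mathbf y$ and covariance $k(s,t)-\mathbf k_n(s)^T(\mathbf K_{nn}+\mathbf I_n)^{-1}\mathbf k_n(t)$. Then for every sequence $M_n\to\infty$, as $n\to\infty$, $$E_{f_0}\,Q^*_\gamma\Big(f:|f(x)-f_0(x)|>M_n\big(n^{-\frac{\alpha\wedge\gamma}{1+2\gamma}}+n^{\frac{2}{1+2\gamma}}m_n^{-(1+\alpha)}+n^{\frac{1/2-\gamma}{1+2\gamma}}m_n^{-3/2}\big)\,\Big|\,\mathbf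 y\Big)\to0 .$$ If moreover $m_n\gg n^{\frac{1}{1+2\gamma}\left(\frac{2+\alpha}{1+\alpha}\right)}$ (that is, $n^{\frac{1}{1+2\gamma}\left(\frac{2+\alpha}{1+\alpha}\right)}=o(m_n)$), then the SGPR contracts at the rate of the full posterior: for every $M_n\to\infty$, $$E_{f_0}\,Q^*_\gamma\big(f:|f(x)-f_0(x)|>M_n n^{-\frac{\alpha\wedge\gamma}{1+2\gamma}}\,\big|\,\mathbf y\big)\to0,$$ while, for every $M_n\to\infty$ (and with no condition on $m_n$), the full posterior satisfies $$E_{f_0}\,\Pi\big(f:|f(x)-f_0(x)|>M_n n^{-\frac{\alpha\wedge\gamma}{1+2\gamma}}\,\big|\,\mathbf y\big)\to0.$$ -/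

import Mathlib

open MeasureTheory ProbabilityTheory Filter Topology Matrix

noncomputable section

namespace SGPR

/-- `C^α[0,1]` for `α ∈ (0,1]`: the functions on `[0,1]` with finite Hölder seminorm of order `α`. -/
def IsHolder (α : ℝ) (f : unitInterval → ℝ) : Prop :=
  ∃ L : ℝ, ∀ s t : unitInterval, |f s - f t| ≤ L * |(s : ℝ) - (t : ℝ)| ^ α

/-- The law `GP(ν, k)` on functions `X → ℝ` (with the product σ-algebra): all finite-dimensional
marginals are Gaussian, the mean function is `ν` and the covariance function is `k`. -/
structure IsGaussianProcessLaw {X : Type*} (Q : Measure (X → ℝ)) (ν : X → ℝ) (k : X → X → ℝ) :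
    Prop where
  gaussian : IsGaussianProcess (fun (t : X) (f : X → ℝ) ↦ f t) Q
  mean : ∀ t, ∫ f, f t ∂Q = ν t
  cov : ∀ s t, cov[fun f : X → ℝ ↦ f s, fun f ↦ f t; Q] = k s t

section Regression

variable {X : Type*} {n m : ℕ}

/-- The law `P_f` of `y`, where `y_i = f(x_i) + ε_i` with i.i.d. errors `ε_i ~ N(0, s2)`. -/
def dataLaw (s2 : NNReal) (p : Fin n → X) (f : X → ℝ) : Measure (Fin n → ℝ) :=
  Measure.pi fun i ↦ gaussianReal (f (p i)) s2

/-- The kernel matrix `K_nn`. -/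
def kernelMatrix (k : X → X → ℝ) (p : Fin n → X) : Matrix (Fin n) (Fin n) ℝ :=
  Matrix.of fun i j ↦ k (p i) (p j)

/-- The vector `k_n(x)`. -/
def kernelVec (k : X → X → ℝ) (p : Fin n → X) (x : X) : Fin n → ℝ :=
  fun i ↦ k x (p i)

/-- Mean function of the posterior for the prior `GP(0, k)`:
`k_n(x)ᵀ (K_nn + s2 I)⁻¹ y`. -/
def posteriorMean (s2 : ℝ) (k : X → X → ℝ) (p : Fin n → X) (y : Fin n → ℝ) (x : X) : ℝ :=
  kernelVec k p x ⬝ᵥ ((kernelMatrix k p + s2 • (1 : Matrix (Fin n) (Fin n) ℝ))⁻¹ *ᵥ y)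

/-- Covariance function of the posterior for the prior `GP(0, k)`:
`k(x, x') - k_n(x)ᵀ (K_nn + s2 I)⁻¹ k_n(x')`. -/
def posteriorCov (s2 : ℝ) (k : X → X → ℝ) (p : Fin n → X) (x x' : X) : ℝ :=
  k x x' - kernelVec k p x ⬝ᵥ
    ((kernelMatrix k p + s2 • (1 : Matrix (Fin n) (Fin n) ℝ))⁻¹ *ᵥ kernelVec k p x')

/-! In the next five definitions the inducing variables are `u_j = ∑ i, W i j * f (x_i)`, and the
covariances are those under the prior `f ~ GP(0, k)`. -/

/-- `K_xm = (cov(f(x), u_1), …, cov(f(x), u_m))`. -/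
def inducingVec (k : X → X → ℝ) (p : Fin n → X) (W : Matrix (Fin n) (Fin m) ℝ) (x : X) :
    Fin m → ℝ :=
  fun j ↦ ∑ i, W i j * k x (p i)

/-- `K_mm`, with entries `cov(u_i, u_j)`. -/
def inducingMatrix (k : X → X → ℝ) (p : Fin n → X) (W : Matrix (Fin n) (Fin m) ℝ) :
    Matrix (Fin m) (Fin m) ℝ :=
  Matrix.of fun i j ↦ ∑ l, ∑ l', W l i * W l' j * k (p l) (p l')

/-- `K_nm`, with entries `cov(f(x_i), u_j)`. -/
def crossMatrix (k : X → X → ℝ) (p : Fin n → X) (W : Matrix (Fin n) (Fin m) ℝ) :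
    Matrix (Fin n) (Fin m) ℝ :=
  Matrix.of fun i j ↦ inducingVec k p W (p i) j

/-- Mean function of the SGPR: `K_xm (s2 K_mm + K_mn K_nm)⁻¹ K_mn y`. -/
def sgprMean (s2 : ℝ) (k : X → X → ℝ) (p : Fin n → X) (W : Matrix (Fin n) (Fin m) ℝ)
    (y : Fin n → ℝ) (x : X) : ℝ :=
  inducingVec k p W x ⬝ᵥ
    ((s2 • inducingMatrix k p W + (crossMatrix k p W)ᵀ * crossMatrix k p W)⁻¹ *ᵥ
      ((crossMatrix k p W)ᵀ *ᵥ y))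

/-- Covariance function of the SGPR:
`k(x, x') - K_xm K_mm⁻¹ K_mx' + K_xm (K_mm + s2⁻¹ K_mn K_nm)⁻¹ K_mx'`. -/
def sgprCov (s2 : ℝ) (k : X → X → ℝ) (p : Fin n → X) (W : Matrix (Fin n) (Fin m) ℝ)
    (x x' : X) : ℝ :=
  k x x' - inducingVec k p W x ⬝ᵥ ((inducingMatrix k p W)⁻¹ *ᵥ inducingVec k p W x')
    + inducingVec k p W x ⬝ᵥ
      ((inducingMatrix k p W + s2⁻¹ • ((crossMatrix k p W)ᵀ * crossMatrix k p W))⁻¹ *ᵥ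
        inducingVec k p W x')

/-- `v 0, …, v (n-1)` is an orthonormal basis of eigenvectors of `K`, with eigenvalues
`μ 0 ≥ … ≥ μ (n-1)`. -/
structure IsSortedEigenbasis (K : Matrix (Fin n) (Fin n) ℝ) (μ : Fin n → ℝ)
    (v : Fin n → Fin n → ℝ) : Prop where
  antitone : Antitone μ
  orthonormal : ∀ i j, v i ⬝ᵥ v j = if i = j then 1 else 0
  eigen : ∀ j, K *ᵥ v j = μ j • v j

/-- The `n × m` matrix `[v_1 … v_m]`: weights of the eigenvector inducing variables
`u_j = ∑ i, v_j^i f(x_i)`, `j = 1, …, m`. -/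
def eigenWeights (v : Fin n → Fin n → ℝ) (h : m ≤ n) : Matrix (Fin n) (Fin m) ℝ :=
  Matrix.of fun i j ↦ v (Fin.castLE h j) i

end Regression

/-- The design points `x_i = i / (n + 1/2)`, `i = 1, …, n` (the index `i : Fin n` starts at `0`). -/
def designPoint (n : ℕ) (i : Fin n) : unitInterval :=
  ⟨((i : ℝ) + 1) / ((n : ℝ) + 1 / 2), by positivity, by
    have h : ((i : ℕ) : ℝ) + 1 ≤ (n : ℝ) := by exact_mod_cast i.2
    rw [div_le_one (by positivity)]
    linarith⟩

/-- Covariance kernel `(n + 1/2)^((1-2γ)/(1+2γ)) * min x x'` of the rescaled Brownian motion. -/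
def rbmKernel (γ : ℝ) (n : ℕ) (x x' : unitInterval) : ℝ :=
  ((n : ℝ) + 1 / 2) ^ ((1 - 2 * γ) / (1 + 2 * γ)) * min (x : ℝ) (x' : ℝ)

/-- The data-dependent distributions `Q n y` contract about `f₀` at the point `x` with rate `ε n`:
for every `M_n → ∞`, `E Q_n(f : |f(x) - f₀(x)| > M_n ε_n | y) → 0`, with `y ~ P n`. -/
def ContractsAt {X : Type*} (P : (n : ℕ) → Measure (Fin n → ℝ))
    (Q : (n : ℕ) → (Fin n → ℝ) → Measure (X → ℝ)) (f₀ : X → ℝ) (x : X) (ε : ℕ → ℝ) : Prop :=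
  ∀ M : ℕ → ℝ, Tendsto M atTop atTop →
    Tendsto (fun n ↦ ∫⁻ y, Q n y {f | M n * ε n < |f x - f₀ x|} ∂(P n)) atTop (𝓝 0)

end SGPR

end

/-!
Only the value at `x` of each random function matters, and its mean is linear in the data. By
Chebyshev's inequality (`contractsAt_of_second_moment`) it is enough to bound the posterior variance,
the variance of the posterior mean and its squared bias, all at `x`, by the squared rate.

In the eigenbasis `v_j`, `μ_j` of the kernel matrix all matrices of the SGPR are diagonal, and the
SGPR mean and variance are those of the full posterior with the eigenexpansion cut after `m` terms
(`IsSortedEigenbasis.sgprMean_eq`, `IsSortedEigenbasis.sgprCov_self_eq`). The full posterior is the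
case `m = n`. Write `N = n + 1/2`. The kernel matrix is the Green matrix of the discrete Laplacian
with a Dirichlet condition at `0` and a Neumann condition at the right end, so its eigenvectors are
the sines `sin (i (j + 1/2) π / N)`; since the eigenvalues are distinct, every sorted orthonormal
eigenbasis consists of these up to sign (`IsSortedEigenbasis.projection_eq`). With
`J = N ^ (1 / (1 + 2γ))` (`cutoff`), this gives `μ_j ≤ (J / (j + 1)) ^ 2` and eigenvectors of
squared size at most `2 / N` at every point.

* Variances: `∑ j, min 1 μ_j ≤ 3 J`, so the full posterior contributes `J / N`, the square of
  `N ^ (-γ / (1 + 2γ))`. Cutting the expansion adds at most a multiple of `J ^ 2 / (m N)`, which is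
  dominated by `J / N` if `m ≥ J` and by the squared truncation bias if `m ≤ J`
  (`excess_variance_le`).
* Bias of the full posterior: for noiseless data its mean solves `g - a g'' = f` in discrete form
  with `a = (N / J) ^ 2`. A quadratic barrier and the discrete maximum principle show that `g` is
  within a multiple of `J ^ (-α)` of `f` at interior points (`abs_resolvent_sub_le`); the mismatch
  at the Dirichlet end is absorbed by the barrier, which grows like `J ^ (2 - α)` there.
* Truncation bias: the sine coefficients of an `α`-Hölder sequence are of order
  `N (j + 1) ^ (-α)` (`abs_sum_mul_sin_le`), so the discarded terms add up to a multiple of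
  `J ^ 2 m ^ (-(1 + α))` (`IsSortedEigenbasis.abs_tail_bias_le`).

Points between two design points are reached by linear interpolation, which is exact for the kernel
vector and leaves a Brownian bridge of negligible variance (`exists_interpolation`).
-/

namespace SGPR

/-! ### Spectral form of the SGPR and of the posterior -/

section Spectral

variable {X : Type*} {n m : ℕ} {K : Matrix (Fin n) (Fin n) ℝ} {μ : Fin n → ℝ}
  {v : Fin n → Fin n → ℝ}

/-- Parseval's identity for an orthonormal eigenbasis. -/
lemma IsSortedEigenbasis.parseval (h : IsSortedEigenbasis K μ v) (a b : Fin n → ℝ) :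
    ∑ j, (a ⬝ᵥ v j) * (v j ⬝ᵥ b) = a ⬝ᵥ b := by
  have h1 : (Matrix.of v) * (Matrix.of v)ᵀ = 1 := by
    ext i j
    simpa [Matrix.mul_apply, Matrix.one_apply, dotProduct] using h.orthonormal i j
  have h2 : (Matrix.of v)ᵀ * (Matrix.of v) = 1 := mul_eq_one_comm.mp h1
  calc ∑ j, (a ⬝ᵥ v j) * (v j ⬝ᵥ b)
      = (Matrix.of v *ᵥ a) ⬝ᵥ (Matrix.of v *ᵥ b) := by
        simp only [dotProduct, mulVec, Matrix.of_apply]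
        simp_rw [mul_comm (a _)]
    _ = a ⬝ᵥ b := by
        rw [Matrix.dotProduct_mulVec, Matrix.vecMul_mulVec, ← Matrix.dotProduct_mulVec, h2,
          Matrix.one_mulVec]

lemma IsSortedEigenbasis.mulVec_dotProduct (h : IsSortedEigenbasis K μ v) (hK : Kᵀ = K)
    (b : Fin n → ℝ) (j : Fin n) : (K *ᵥ b) ⬝ᵥ v j = μ j * (b ⬝ᵥ v j) := by
  rw [dotProduct_comm, dotProduct_mulVec, ← mulVec_transpose, hK, h.eigen, smul_dotProduct,
    smul_eq_mul, dotProduct_comm]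

/-- The spectral form of `K`. -/
lemma IsSortedEigenbasis.dotProduct_mulVec_eq_sum (h : IsSortedEigenbasis K μ v)
    (hK : Kᵀ = K) (a b : Fin n → ℝ) :
    a ⬝ᵥ (K *ᵥ b) = ∑ j, μ j * ((a ⬝ᵥ v j) * (v j ⬝ᵥ b)) := by
  rw [← h.parseval a (K *ᵥ b)]
  refine Finset.sum_congr rfl fun j _ ↦ ?_
  rw [dotProduct_comm (v j) (K *ᵥ b), h.mulVec_dotProduct hK, dotProduct_comm b]
  ring

/-- The spectral form of the resolvent `(K + I)⁻¹`. -/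
lemma IsSortedEigenbasis.exists_resolvent (h : IsSortedEigenbasis K μ v)
    (hK : Kᵀ = K) (hμ : ∀ j, 0 ≤ μ j) :
    ∃ R : Matrix (Fin n) (Fin n) ℝ, (K + (1 : ℝ) • (1 : Matrix (Fin n) (Fin n) ℝ)) * R = 1 ∧
      ∀ a b : Fin n → ℝ, a ⬝ᵥ (R *ᵥ b) = ∑ j, (a ⬝ᵥ v j) * (v j ⬝ᵥ b) / (1 + μ j) := by
  set R : Matrix (Fin n) (Fin n) ℝ := Matrix.of fun i l ↦ ∑ j, v j i * v j l / (1 + μ j) with hR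
  have hRv : ∀ c d : Fin n → ℝ, c ⬝ᵥ (R *ᵥ d) = ∑ j, (c ⬝ᵥ v j) * (v j ⬝ᵥ d) / (1 + μ j) := by
    intro c d
    simp only [dotProduct, mulVec, hR, Matrix.of_apply, Finset.mul_sum, Finset.sum_mul,
      Finset.sum_div]
    rw [Finset.sum_congr rfl fun i _ ↦ Finset.sum_comm, Finset.sum_comm]
    refine Finset.sum_congr rfl fun j _ ↦ Finset.sum_comm.trans ?_
    refine Finset.sum_congr rfl fun j _ ↦ Finset.sum_congr rfl fun j _ ↦ ?_
    ring
  have hinv : (K + (1 : ℝ) • (1 : Matrix (Fin n) (Fin n) ℝ)) * R = 1 := by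
    refine Matrix.ext_of_mulVec_single fun l ↦ ?_
    rw [one_mulVec]
    refine dotProduct_eq _ _ fun c ↦ ?_
    rw [dotProduct_comm _ c, dotProduct_comm _ c, ← Matrix.mulVec_mulVec, one_smul, add_mulVec,
      one_mulVec, dotProduct_add, h.dotProduct_mulVec_eq_sum hK, hRv, ← h.parseval c,
      ← Finset.sum_add_distrib]
    refine Finset.sum_congr rfl fun j _ ↦ ?_
    have h1 : (1 + μ j) ≠ 0 := by have := hμ j; positivity
    have : v j ⬝ᵥ (R *ᵥ Pi.single l 1) = (v j ⬝ᵥ Pi.single l 1) / (1 + μ j) := by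
      rw [hRv, Finset.sum_eq_single j]
      · rw [h.orthonormal]; simp
      · intro b _ hb; rw [h.orthonormal, if_neg hb.symm]; simp
      · simp
    rw [this]; field_simp; ring
  exact ⟨R, hinv, hRv⟩

lemma IsSortedEigenbasis.dotProduct_inv_mulVec (h : IsSortedEigenbasis K μ v)
    (hK : Kᵀ = K) (hμ : ∀ j, 0 ≤ μ j) (a b : Fin n → ℝ) :
    a ⬝ᵥ ((K + (1 : ℝ) • (1 : Matrix (Fin n) (Fin n) ℝ))⁻¹ *ᵥ b)
      = ∑ j, (a ⬝ᵥ v j) * (v j ⬝ᵥ b) / (1 + μ j) := by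
  obtain ⟨R, hinv, hR⟩ := h.exists_resolvent hK hμ
  rw [Matrix.inv_eq_right_inv hinv, hR]

variable {k : X → X → ℝ} {p : Fin n → X}

lemma inducingVec_eigenWeights (h : m ≤ n) (x : X) (j : Fin m) :
    inducingVec k p (eigenWeights v h) x j = kernelVec k p x ⬝ᵥ v (Fin.castLE h j) := by
  simp [inducingVec, eigenWeights, kernelVec, dotProduct, mul_comm]

lemma IsSortedEigenbasis.inducingMatrix_eq
    (hv : IsSortedEigenbasis (kernelMatrix k p) μ v) (h : m ≤ n) :
    inducingMatrix k p (eigenWeights v h) = diagonal fun j ↦ μ (Fin.castLE h j) := by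
  ext i j
  have : inducingMatrix k p (eigenWeights v h) i j
      = v (Fin.castLE h i) ⬝ᵥ (kernelMatrix k p *ᵥ v (Fin.castLE h j)) := by
    simp only [inducingMatrix, eigenWeights, dotProduct, mulVec, kernelMatrix, Matrix.of_apply,
      Finset.mul_sum]
    refine Finset.sum_congr rfl fun _ _ ↦ Finset.sum_congr rfl fun _ _ ↦ by ring
  rw [this, hv.eigen, dotProduct_smul, hv.orthonormal, diagonal_apply]
  by_cases hij : i = j
  · simp [hij]
  · have : Fin.castLE h i ≠ Fin.castLE h j := fun e ↦ hij (Fin.castLE_injective h e)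
    simp [hij]

lemma IsSortedEigenbasis.crossMatrix_apply
    (hv : IsSortedEigenbasis (kernelMatrix k p) μ v) (h : m ≤ n) (i : Fin n) (j : Fin m) :
    crossMatrix k p (eigenWeights v h) i j = μ (Fin.castLE h j) * v (Fin.castLE h j) i := by
  have := congrFun (hv.eigen (Fin.castLE h j)) i
  rw [crossMatrix, Matrix.of_apply, inducingVec_eigenWeights]
  simpa [mulVec, kernelMatrix, kernelVec, dotProduct] using this

lemma IsSortedEigenbasis.crossMatrix_transpose_mul
    (hv : IsSortedEigenbasis (kernelMatrix k p) μ v) (h : m ≤ n) :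
    (crossMatrix k p (eigenWeights v h))ᵀ * crossMatrix k p (eigenWeights v h)
      = diagonal fun j ↦ μ (Fin.castLE h j) ^ 2 := by
  ext i j
  have h1 := hv.orthonormal (Fin.castLE h i) (Fin.castLE h j)
  rw [Matrix.mul_apply]
  simp only [transpose_apply, hv.crossMatrix_apply]
  have : ∑ l, μ (Fin.castLE h i) * v (Fin.castLE h i) l
      * (μ (Fin.castLE h j) * v (Fin.castLE h j) l)
      = μ (Fin.castLE h i) * μ (Fin.castLE h j)
        * (v (Fin.castLE h i) ⬝ᵥ v (Fin.castLE h j)) := by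
    rw [dotProduct, Finset.mul_sum]
    exact Finset.sum_congr rfl fun _ _ ↦ by ring
  rw [this, h1, diagonal_apply]
  by_cases hij : i = j
  · subst hij; simp [sq]
  · have : Fin.castLE h i ≠ Fin.castLE h j := fun e ↦ hij (Fin.castLE_injective h e)
    simp [hij]

lemma dotProduct_diagonal_inv_mulVec {d : Fin m → ℝ} (hd : ∀ j, d j ≠ 0) (a b : Fin m → ℝ) :
    a ⬝ᵥ ((diagonal d)⁻¹ *ᵥ b) = ∑ j, a j * b j / d j := by
  have : (diagonal d)⁻¹ = diagonal fun j ↦ (d j)⁻¹ := by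
    refine Matrix.inv_eq_right_inv ?_
    rw [diagonal_mul_diagonal, ← diagonal_one]
    congr 1; ext j; exact mul_inv_cancel₀ (hd j)
  rw [this]
  simp only [dotProduct, mulVec_diagonal]
  exact Finset.sum_congr rfl fun j _ ↦ by rw [div_eq_mul_inv]; ring

lemma sum_castLE (h : m ≤ n) (F : Fin n → ℝ) :
    ∑ j : Fin m, F (Fin.castLE h j) = ∑ j with j.val < m, F j := by
  refine Finset.sum_bij (fun j _ ↦ Fin.castLE h j) (by simp)
    (fun a _ b _ e ↦ Fin.castLE_injective h e) (fun b hb ↦ ?_) (fun _ _ ↦ rfl)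
  simp only [Finset.mem_filter, Finset.mem_univ, true_and] at hb
  exact ⟨⟨b, hb⟩, by simp, rfl⟩

/-- The SGPR mean keeps the first `m` terms of the eigenexpansion of the posterior mean. -/
lemma IsSortedEigenbasis.sgprMean_eq
    (hv : IsSortedEigenbasis (kernelMatrix k p) μ v) (hμ : ∀ j, 0 < μ j) (h : m ≤ n)
    (y : Fin n → ℝ) (x : X) :
    sgprMean 1 k p (eigenWeights v h) y x
      = ∑ j with j.val < m, (kernelVec k p x ⬝ᵥ v j) * (v j ⬝ᵥ y) / (1 + μ j) := by
  rw [← sum_castLE h fun j ↦ (kernelVec k p x ⬝ᵥ v j) * (v j ⬝ᵥ y) / (1 + μ j)]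
  rw [sgprMean, hv.inducingMatrix_eq, hv.crossMatrix_transpose_mul, one_smul, diagonal_add,
    dotProduct_diagonal_inv_mulVec]
  · refine Finset.sum_congr rfl fun j _ ↦ ?_
    have : ((crossMatrix k p (eigenWeights v h))ᵀ *ᵥ y) j
        = μ (Fin.castLE h j) * (v (Fin.castLE h j) ⬝ᵥ y) := by
      simp only [mulVec, dotProduct, transpose_apply, hv.crossMatrix_apply, Finset.mul_sum,
        mul_assoc]
    rw [this, inducingVec_eigenWeights]
    have := hμ (Fin.castLE h j)
    field_simp
  · intro j
    have := hμ (Fin.castLE h j)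
    positivity

/-- The SGPR variance keeps the first `m` terms of the eigenexpansion of the posterior
variance. -/
lemma IsSortedEigenbasis.sgprCov_self_eq
    (hv : IsSortedEigenbasis (kernelMatrix k p) μ v) (hμ : ∀ j, 0 < μ j) (h : m ≤ n) (x : X) :
    sgprCov 1 k p (eigenWeights v h) x x
      = k x x - ∑ j with j.val < m, (kernelVec k p x ⬝ᵥ v j) ^ 2 / (1 + μ j) := by
  rw [← sum_castLE h fun j ↦ (kernelVec k p x ⬝ᵥ v j) ^ 2 / (1 + μ j)]
  rw [sgprCov, hv.inducingMatrix_eq, hv.crossMatrix_transpose_mul, inv_one, one_smul,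
    diagonal_add, dotProduct_diagonal_inv_mulVec, dotProduct_diagonal_inv_mulVec, sub_add,
    ← Finset.sum_sub_distrib]
  · congr 1
    refine Finset.sum_congr rfl fun j _ ↦ ?_
    rw [inducingVec_eigenWeights]
    have := hμ (Fin.castLE h j)
    field_simp
    ring
  · intro j
    have := hμ (Fin.castLE h j)
    positivity
  · intro j
    exact (hμ (Fin.castLE h j)).ne'

lemma IsSortedEigenbasis.posteriorMean_eq
    (hv : IsSortedEigenbasis (kernelMatrix k p) μ v) (hμ : ∀ j, 0 < μ j)
    (hK : (kernelMatrix k p)ᵀ = kernelMatrix k p) (y : Fin n → ℝ) (x : X) :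
    posteriorMean 1 k p y x
      = ∑ j with j.val < n, (kernelVec k p x ⬝ᵥ v j) * (v j ⬝ᵥ y) / (1 + μ j) := by
  rw [posteriorMean, hv.dotProduct_inv_mulVec hK fun j ↦ (hμ j).le]
  simp

lemma IsSortedEigenbasis.posteriorCov_self_eq
    (hv : IsSortedEigenbasis (kernelMatrix k p) μ v) (hμ : ∀ j, 0 < μ j)
    (hK : (kernelMatrix k p)ᵀ = kernelMatrix k p) (x : X) :
    posteriorCov 1 k p x x
      = k x x - ∑ j with j.val < n, (kernelVec k p x ⬝ᵥ v j) ^ 2 / (1 + μ j) := by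
  rw [posteriorCov, hv.dotProduct_inv_mulVec hK fun j ↦ (hμ j).le]
  simp [dotProduct_comm (v _), sq]

end Spectral

/-! ### Chebyshev's inequality and contraction -/

section Probability

variable {X : Type*} {n : ℕ}

/-- Chebyshev's inequality for the value at a point of a Gaussian process. -/
lemma IsGaussianProcessLaw.measure_abs_sub_lt_le {Q : Measure (X → ℝ)} {ν : X → ℝ}
    {k : X → X → ℝ} (hQ : IsGaussianProcessLaw Q ν k) (x : X) (a : ℝ) {r : ℝ} (hr : 0 < r) :
    Q {f | r < |f x - a|} ≤ ENNReal.ofReal ((k x x + (ν x - a) ^ 2) / r ^ 2) := by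
  have hg := hQ.gaussian.hasGaussianLaw_eval x
  have := hg.isProbabilityMeasure
  have hL2 : MemLp (fun f : X → ℝ ↦ f x) 2 Q := hg.memLp_two
  have hL2' : MemLp (fun f : X → ℝ ↦ f x - a) 2 Q := hL2.sub (memLp_const a)
  have hsq : ∫ f, (f x - a) ^ 2 ∂Q = k x x + (ν x - a) ^ 2 := by
    have h1 := variance_eq_sub hL2'
    have h2 : Var[fun f : X → ℝ ↦ f x - a; Q] = k x x := by
      rw [variance_sub_const hL2.aestronglyMeasurable, ← hQ.cov x x,
        covariance_self hL2.aestronglyMeasurable.aemeasurable]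
    have h3 : ∫ f : X → ℝ, (f x - a) ∂Q = ν x - a := by
      rw [integral_sub (hL2.integrable one_le_two) (integrable_const a), hQ.mean]
      simp
    rw [h2, h3] at h1
    simp only [Pi.pow_apply] at h1
    linarith
  have hsub : {f : X → ℝ | r < |f x - a|} ⊆ {f | r ^ 2 ≤ (f x - a) ^ 2} := by
    intro f hf
    have : r < |f x - a| := hf
    show r ^ 2 ≤ (f x - a) ^ 2
    rw [← sq_abs (f x - a)]
    gcongr
  have hmarkov := mul_meas_ge_le_integral_of_nonneg (μ := Q) (f := fun f : X → ℝ ↦ (f x - a) ^ 2)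
    (ae_of_all _ fun f ↦ sq_nonneg _) hL2'.integrable_sq (r ^ 2)
  rw [hsq] at hmarkov
  refine (measure_mono hsub).trans ?_
  rw [← ofReal_measureReal]
  refine ENNReal.ofReal_le_ofReal ?_
  rw [le_div_iff₀ (by positivity), mul_comm]
  exact hmarkov

/-- The mean squared error of a linear estimator is its squared bias plus its variance. -/
lemma integral_linear_sub_sq (p : Fin n → X) (f₀ : X → ℝ) (q : Fin n → ℝ) (a : ℝ) :
    Integrable (fun y ↦ (q ⬝ᵥ y - a) ^ 2) (dataLaw 1 p f₀) ∧
    ∫ y, (q ⬝ᵥ y - a) ^ 2 ∂(dataLaw 1 p f₀)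
      = q ⬝ᵥ q + (q ⬝ᵥ (fun i ↦ f₀ (p i)) - a) ^ 2 := by
  have hP : IsProbabilityMeasure (dataLaw 1 p f₀) := by unfold dataLaw; infer_instance
  have hmem : ∀ i, MemLp (fun t : ℝ ↦ q i * t) 2 (gaussianReal (f₀ (p i)) 1) := fun i ↦
    (memLp_id_gaussianReal 2).const_mul (q i)
  have hmem' : ∀ i, MemLp (fun y : Fin n → ℝ ↦ q i * y i) 2 (dataLaw 1 p f₀) := fun i ↦
    (hmem i).comp_measurePreserving
      (measurePreserving_eval (fun i ↦ gaussianReal (f₀ (p i)) 1) i)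
  have hL2 : MemLp (fun y : Fin n → ℝ ↦ q ⬝ᵥ y) 2 (dataLaw 1 p f₀) := by
    simp only [dotProduct]
    exact memLp_finsetSum _ fun i _ ↦ hmem' i
  have hL2' : MemLp (fun y : Fin n → ℝ ↦ q ⬝ᵥ y - a) 2 (dataLaw 1 p f₀) :=
    hL2.sub (memLp_const a)
  refine ⟨hL2'.integrable_sq, ?_⟩
  have h1 := variance_eq_sub hL2'
  have h2 : Var[fun y : Fin n → ℝ ↦ q ⬝ᵥ y - a; dataLaw 1 p f₀] = q ⬝ᵥ q := by
    rw [variance_sub_const hL2.aestronglyMeasurable]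
    have h := variance_sum_pi (μ := fun i ↦ gaussianReal (f₀ (p i)) 1)
      (X := fun i t ↦ q i * t) hmem
    have e : (fun y : Fin n → ℝ ↦ q ⬝ᵥ y) = ∑ i, fun ω : Fin n → ℝ ↦ q i * ω i := by
      ext y; simp [dotProduct]
    rw [e]
    refine h.trans ?_
    simp only [dotProduct]
    refine Finset.sum_congr rfl fun i _ ↦ ?_
    rw [variance_const_mul, variance_fun_id_gaussianReal]
    simp [sq]
  have h3 : ∫ y : Fin n → ℝ, (q ⬝ᵥ y - a) ∂(dataLaw 1 p f₀)
      = q ⬝ᵥ (fun i ↦ f₀ (p i)) - a := by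
    rw [integral_sub (hL2.integrable one_le_two) (integrable_const a)]
    simp only [dotProduct]
    rw [integral_finsetSum _ fun i _ ↦ (hmem' i).integrable one_le_two]
    simp only [integral_const, probReal_univ, one_smul]
    congr 1
    refine Finset.sum_congr rfl fun i _ ↦ ?_
    rw [integral_const_mul]
    congr 1
    have h4 := integral_comp_eval (μ := fun i ↦ gaussianReal (f₀ (p i)) 1) (i := i)
      (f := fun t : ℝ ↦ t) aestronglyMeasurable_id
    rw [dataLaw, h4]
    exact integral_id_gaussianReal
  rw [h2, h3] at h1
  simp only [Pi.pow_apply] at h1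
  linarith

/-- Second moment criterion: the distributions `Q n y`, whose means are linear in the data,
contract at every rate that eventually dominates the root of the variance plus the mean squared
error of the posterior mean. -/
lemma contractsAt_of_second_moment (p : (n : ℕ) → Fin n → X) (f₀ : X → ℝ) (x : X)
    (Q : (n : ℕ) → (Fin n → ℝ) → Measure (X → ℝ))
    (ν : (n : ℕ) → (Fin n → ℝ) → X → ℝ) (k : ℕ → X → X → ℝ)
    (hQ : ∀ n y, IsGaussianProcessLaw (Q n y) (ν n y) (k n))
    (q : (n : ℕ) → Fin n → ℝ) (hq : ∀ n y, ν n y x = q n ⬝ᵥ y) (ε : ℕ → ℝ) (C : ℝ)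
    (hε : ∀ᶠ n in atTop, 0 < ε n)
    (hC : ∀ᶠ n in atTop, k n x x + q n ⬝ᵥ q n
      + (q n ⬝ᵥ (fun i ↦ f₀ (p n i)) - f₀ x) ^ 2 ≤ C * ε n ^ 2) :
    ContractsAt (fun n ↦ dataLaw 1 (p n) f₀) Q f₀ x ε := by
  intro M hM
  have hlim : Tendsto (fun n ↦ ENNReal.ofReal (C / M n ^ 2)) atTop (𝓝 0) := by
    rw [← ENNReal.ofReal_zero]
    refine ENNReal.tendsto_ofReal ?_
    exact Tendsto.div_atTop tendsto_const_nhds ((tendsto_pow_atTop two_ne_zero).comp hM)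
  refine tendsto_of_tendsto_of_tendsto_of_le_of_le' tendsto_const_nhds hlim
    (Eventually.of_forall fun _ ↦ zero_le) ?_
  filter_upwards [hε, hC, hM.eventually_gt_atTop 0] with n hεn hCn hMn
  have hr : 0 < M n * ε n := mul_pos hMn hεn
  have hP : IsProbabilityMeasure (dataLaw 1 (p n) f₀) := by unfold dataLaw; infer_instance
  obtain ⟨hint, heq⟩ := integral_linear_sub_sq (p n) f₀ (q n) (f₀ x)
  have hk : 0 ≤ k n x x := by
    rw [← (hQ n 0).cov x x,
      covariance_self ((hQ n 0).gaussian.hasGaussianLaw_eval x).aemeasurable]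
    exact variance_nonneg _ _
  calc ∫⁻ y, Q n y {f | M n * ε n < |f x - f₀ x|} ∂(dataLaw 1 (p n) f₀)
      ≤ ∫⁻ y, ENNReal.ofReal ((k n x x + (q n ⬝ᵥ y - f₀ x) ^ 2) / (M n * ε n) ^ 2)
          ∂(dataLaw 1 (p n) f₀) := by
        refine lintegral_mono fun y ↦ ?_
        rw [← hq]
        exact (hQ n y).measure_abs_sub_lt_le x (f₀ x) hr
    _ = ENNReal.ofReal ((k n x x + q n ⬝ᵥ q n
          + (q n ⬝ᵥ (fun i ↦ f₀ (p n i)) - f₀ x) ^ 2) / (M n * ε n) ^ 2) := by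
        have hint' : Integrable (fun y ↦ (k n x x + (q n ⬝ᵥ y - f₀ x) ^ 2) / (M n * ε n) ^ 2)
            (dataLaw 1 (p n) f₀) := ((integrable_const _).add hint).div_const _
        rw [← ofReal_integral_eq_lintegral_ofReal hint' (ae_of_all _ fun y ↦ by positivity)]
        rw [integral_div, integral_add (integrable_const _) hint, heq]
        simp [add_assoc]
    _ ≤ ENNReal.ofReal (C / M n ^ 2) := by
        refine ENNReal.ofReal_le_ofReal ?_
        rw [div_le_div_iff₀ (by positivity) (by positivity)]
        calc _ ≤ C * ε n ^ 2 * M n ^ 2 := by gcongr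
          _ = _ := by ring

end Probability

/-! ### Discrete maximum principle -/

section MaximumPrinciple

variable {n : ℕ}

/-- Discrete maximum principle for `ψ - a ψ''` with a Dirichlet condition at `0` and a Neumann
condition at `n`; the latter is expressed through the ghost value `ψ (n + 1)`. -/
lemma nonneg_of_supersolution {ψ : ℕ → ℝ} {a : ℝ} (ha : 0 ≤ a) (h0 : 0 ≤ ψ 0)
    (hn : ψ n ≤ ψ (n + 1))
    (hψ : ∀ i < n, 0 ≤ ψ (i + 1) + a * (2 * ψ (i + 1) - ψ i - ψ (i + 2))) {i : ℕ} (hi : i ≤ n) :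
    0 ≤ ψ i := by
  obtain ⟨i₀, hi₀, hmin⟩ := Finset.exists_min_image (Finset.range (n + 1)) ψ ⟨0, by simp⟩
  have hi₀n : i₀ ≤ n := by simpa [Nat.lt_succ_iff] using hi₀
  have hmin' : ∀ l ≤ n, ψ i₀ ≤ ψ l := fun l hl ↦ hmin l (by simp; omega)
  refine le_trans ?_ (hmin' i hi)
  by_contra! hneg
  obtain _ | l := i₀
  · linarith
  have h1 := hmin' l (by omega)
  have h2 : ψ (l + 1) ≤ ψ (l + 2) := by
    rcases Nat.lt_or_ge (l + 1) n with h | h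
    · exact hmin' (l + 2) (by omega)
    · obtain rfl : n = l + 1 := by omega
      exact hn
  have h3 := hψ l (by omega)
  nlinarith

/-- A solution of `g - a g'' = f` with mixed boundary conditions stays within `3 L J ^ (-α)` of an
`α`-Hölder right-hand side at the grid point `l`, where `a = (N / J) ^ 2`, so that `1 / J` is the
bandwidth. The value at `l` has to be dominated by the squared distance of `l` to the Dirichlet
end. -/
lemma abs_resolvent_sub_le {g f : ℕ → ℝ} {N J L α : ℝ} {l : ℕ} (hl : l ≤ n) (hN : 0 < N)
    (hJ : 1 ≤ J) (hL : 0 ≤ L) (hα0 : 0 ≤ α) (hα1 : α ≤ 2) (hg0 : g 0 = 0) (hgn : g (n + 1) = g n)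
    (hg : ∀ i < n, g (i + 1) + (N / J) ^ 2 * (2 * g (i + 1) - g i - g (i + 2)) = f (i + 1))
    (hf : ∀ i ≤ n, |f i - f l| ≤ L * (|(i : ℝ) - l| / N) ^ α)
    (hfl : |f l| ≤ L * (l / N) ^ 2) :
    |g l - f l| ≤ 3 * L * J ^ (-α) := by
  have hJ0 : 0 < J := by linarith
  set E : ℝ := L * J ^ (-α) with hE
  have hE0 : 0 ≤ E := by positivity
  -- The quadratic barrier: its second difference is exactly `2 E (J / N) ^ 2`.
  set φ : ℕ → ℝ := fun i ↦ E * (3 + (((i : ℝ) - l) * J / N) ^ 2) with hφ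
  have hφ_eq : ∀ i : ℕ, φ (i + 1) + (N / J) ^ 2 * (2 * φ (i + 1) - φ i - φ (i + 2))
      = E * (1 + (((i + 1 : ℕ) - l : ℝ) * J / N) ^ 2) := by
    intro i
    simp only [hφ]
    push_cast
    field_simp
    ring
  have hφ0 : |f l| ≤ φ 0 := by
    refine hfl.trans ?_
    have h1 : (1 : ℝ) ≤ J ^ (-α) * J ^ 2 := by
      rw [← Real.rpow_natCast J 2, ← Real.rpow_add hJ0]
      exact Real.one_le_rpow hJ (by push_cast; linarith)
    calc L * (l / N) ^ 2 = L * 1 * (l / N) ^ 2 := by ring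
      _ ≤ L * (J ^ (-α) * J ^ 2) * (l / N) ^ 2 := by gcongr
      _ = E * ((((0 : ℕ) : ℝ) - l) * J / N) ^ 2 := by rw [hE]; push_cast; ring
      _ ≤ φ 0 := by simp only [hφ]; gcongr; linarith
  have hφn : φ n ≤ φ (n + 1) := by
    simp only [hφ]
    have : (0 : ℝ) ≤ (n : ℝ) - l := by
      have : (l : ℝ) ≤ n := by exact_mod_cast hl
      linarith
    push_cast
    gcongr
    linarith
  have hfφ : ∀ i ≤ n, |f i - f l| ≤ E * (1 + (((i : ℝ) - l) * J / N) ^ 2) := by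
    intro i hi
    refine (hf i hi).trans ?_
    -- In units of the bandwidth the Hölder modulus `r ^ α` is at most `1 + r ^ 2`.
    set r : ℝ := |(i : ℝ) - l| * J / N with hr
    have hr0 : 0 ≤ r := by positivity
    have h1 : |(i : ℝ) - l| / N = J⁻¹ * r := by rw [hr]; field_simp
    have h2 : (((i : ℝ) - l) * J / N) ^ 2 = r ^ 2 := by
      rw [hr, div_pow, mul_pow, div_pow, mul_pow, sq_abs]
    have h3 : r ^ α ≤ 1 + r ^ 2 := by
      rcases le_total r 1 with h | h
      · have := Real.rpow_le_one hr0 h hα0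
        nlinarith
      · have := Real.rpow_le_rpow_of_exponent_le h hα1
        rw [Real.rpow_two] at this
        linarith
    rw [h1, h2, Real.mul_rpow (by positivity) hr0, Real.inv_rpow hJ0.le, ← Real.rpow_neg hJ0.le,
      ← mul_assoc]
    exact mul_le_mul_of_nonneg_left h3 hE0
  have hfl' := abs_le.mp hφ0
  have up := nonneg_of_supersolution (n := n) (ψ := fun i ↦ φ i - (g i - f l))
    (a := (N / J) ^ 2) (by positivity) (by simp only [hg0]; linarith)
    (by simp only [hgn]; linarith)
    (fun i hi ↦ by
      have h1 := hg i hi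
      have h2 := hφ_eq i
      have h3 := (abs_le.mp (hfφ (i + 1) hi)).2
      linarith) hl
  have down := nonneg_of_supersolution (n := n) (ψ := fun i ↦ φ i + (g i - f l))
    (a := (N / J) ^ 2) (by positivity) (by simp only [hg0]; linarith)
    (by simp only [hgn]; linarith)
    (fun i hi ↦ by
      have h1 := hg i hi
      have h2 := hφ_eq i
      have h3 := (abs_le.mp (hfφ (i + 1) hi)).1
      linarith) hl
  have hφl : φ l = 3 * L * J ^ (-α) := by simp only [hφ, hE]; simp; ring
  simp only [hφl] at up down
  rw [abs_le]
  constructor <;> linarith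

end MaximumPrinciple

/-! ### Sine coefficients of Hölder sequences -/

section SineCoefficients

/-- Shifting a window of length `n` by `r` steps changes a sum of terms bounded by `B` by at most
`2 r B`. -/
lemma abs_sum_shift_sub_le {G : ℤ → ℝ} {B : ℝ} (hG : ∀ i, |G i| ≤ B) (n r : ℕ) :
    |∑ i ∈ Finset.range n, G (i + 1 + r) - ∑ i ∈ Finset.range n, G (i + 1)| ≤ 2 * r * B := by
  induction r with
  | zero => simp
  | succ r ih =>
    have h1 := Finset.sum_range_succ (fun i : ℕ ↦ G (i + 1 + r)) n
    have h2 := Finset.sum_range_succ' (fun i : ℕ ↦ G (i + 1 + r)) n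
    have h3 : ∑ i ∈ Finset.range n, G (i + 1 + (r + 1 : ℕ))
        = ∑ i ∈ Finset.range n, G ((i + 1 : ℕ) + 1 + r) :=
      Finset.sum_congr rfl fun i _ ↦ by congr 1; push_cast; ring
    rw [h3]
    have h4 := abs_le.mp ih
    have h5 := abs_le.mp (hG (n + 1 + r))
    have h6 := abs_le.mp (hG ((0 : ℕ) + 1 + r))
    push_cast at h1 h2 h6 ⊢
    rw [abs_le]
    constructor <;> linarith

/-- Sine coefficients of a Hölder sequence: a sequence bounded by `B` with modulus of continuity
`L (|i - l| / N) ^ α` has a `j`-th coefficient (counted from `0`) of order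
`N (j + 1) ^ (-α)`. The sum is compared with its shifts by about half a period. -/
lemma abs_sum_mul_sin_le {F : ℤ → ℝ} {B L α N : ℝ} {n j : ℕ} (hj : j < n)
    (hN : N = n + 1 / 2) (hL : 0 ≤ L) (hα0 : 0 ≤ α) (hα1 : α ≤ 1)
    (hB : ∀ i, |F i| ≤ B) (hF : ∀ i l, |F i - F l| ≤ L * (|(i : ℝ) - l| / N) ^ α) :
    |∑ i ∈ Finset.range n, F (i + 1) * Real.sin ((i + 1) * ((j + 1 / 2) * Real.pi / N))|
      ≤ (2 * L + 4 * B) * N * ((j : ℝ) + 1) ^ (-α) := by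
  have hB0 : 0 ≤ B := (abs_nonneg _).trans (hB 0)
  have hjn : (j : ℝ) + 1 ≤ n := by exact_mod_cast hj
  have hj0 : (0 : ℝ) ≤ j := by positivity
  have hN0 : 0 < N := by rw [hN]; positivity
  have hjN : (j : ℝ) + 1 ≤ N := by rw [hN]; linarith
  set θ : ℝ := (j + 1 / 2) * Real.pi / N with hθ
  set r : ℕ := ⌈N / (2 * j + 1)⌉₊ with hr
  have hr1 : N / (2 * j + 1) ≤ r := Nat.le_ceil _
  have hr2 : (r : ℝ) < N / (2 * j + 1) + 1 := Nat.ceil_lt_add_one (by positivity)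
  have hr3 : (r : ℝ) ≤ 2 * N / (j + 1) := by
    have h1 : N / (2 * j + 1) ≤ N / (j + 1) := by gcongr; linarith
    have h2 : 1 ≤ N / (j + 1) := by rw [one_le_div (by positivity)]; exact hjN
    calc (r : ℝ) ≤ N / (j + 1) + N / (j + 1) := by linarith
      _ = _ := by ring
  have hcos : Real.cos (r * θ) ≤ 0 := by
    have hπ := Real.pi_pos
    refine Real.cos_nonpos_of_pi_div_two_le_of_le ?_ ?_
    · calc Real.pi / 2 = N / (2 * j + 1) * θ := by rw [hθ]; field_simp
        _ ≤ r * θ := by gcongr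
    · have h1 : r * θ ≤ (N / (2 * j + 1) + 1) * θ := by gcongr
      have h2 : (N / (2 * j + 1) + 1) * θ = Real.pi / 2 + θ := by rw [hθ]; field_simp
      have h3 : θ ≤ Real.pi := by
        rw [hθ, div_le_iff₀ hN0, mul_comm]
        gcongr
        linarith
      linarith
  -- As `cos (r θ) ≤ 0`, the sum `S` is controlled by `2 (1 - cos (r θ)) S`, in which `F` enters
  -- only through its symmetric second differences with step `r`.
  set S : ℝ := ∑ i ∈ Finset.range n, F (i + 1) * Real.sin ((i + 1) * θ) with hS
  have hsin : ∀ t, |Real.sin t| ≤ 1 := Real.abs_sin_le_one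
  have hR := abs_sum_shift_sub_le (G := fun i ↦ F (i - r) * Real.sin (i * θ)) (B := B)
    (fun i ↦ by
      rw [abs_mul]
      calc _ ≤ B * 1 := mul_le_mul (hB _) (hsin _) (abs_nonneg _) hB0
        _ = B := mul_one B) n r
  have hL' := abs_sum_shift_sub_le (G := fun i ↦ F i * Real.sin ((i - r) * θ)) (B := B)
    (fun i ↦ by
      rw [abs_mul]
      calc _ ≤ B * 1 := mul_le_mul (hB _) (hsin _) (abs_nonneg _) hB0
        _ = B := mul_one B) n r
  have hdiff : |∑ i ∈ Finset.range n, (2 * F (i + 1) - F (i + 1 - r) - F (i + 1 + r))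
      * Real.sin ((i + 1) * θ)| ≤ n * (2 * (L * (r / N) ^ α)) := by
    refine (Finset.abs_sum_le_sum_abs _ _).trans ?_
    calc _ ≤ ∑ i ∈ Finset.range n, 2 * (L * ((r : ℝ) / N) ^ α) := by
          refine Finset.sum_le_sum fun i _ ↦ ?_
          have h1 := hF (i + 1) (i + 1 - r)
          have h2 := hF (i + 1) (i + 1 + r)
          push_cast at h1 h2
          rw [show ((i : ℝ) + 1 - (i + 1 - r)) = r by ring, Nat.abs_cast] at h1
          rw [show ((i : ℝ) + 1 - (i + 1 + r)) = -r by ring, abs_neg, Nat.abs_cast] at h2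
          have h3 : |2 * F (i + 1) - F (i + 1 - r) - F (i + 1 + r)|
              ≤ 2 * (L * ((r : ℝ) / N) ^ α) := by
            have h1' := abs_le.mp h1
            have h2' := abs_le.mp h2
            rw [abs_le]
            constructor <;> linarith
          rw [abs_mul]
          calc _ ≤ 2 * (L * ((r : ℝ) / N) ^ α) * 1 :=
                mul_le_mul h3 (hsin _) (abs_nonneg _) (by positivity)
            _ = _ := mul_one _
      _ = _ := by simp
  have hid : 2 * (1 - Real.cos (r * θ)) * S
      = ∑ i ∈ Finset.range n, (2 * F (i + 1) - F (i + 1 - r) - F (i + 1 + r))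
          * Real.sin ((i + 1) * θ)
        - (∑ i ∈ Finset.range n, F (i + 1) * Real.sin ((i + 1 + r) * θ)
          - ∑ i ∈ Finset.range n, F (i + 1 - r) * Real.sin ((i + 1) * θ))
        + (∑ i ∈ Finset.range n, F (i + 1 + r) * Real.sin ((i + 1) * θ)
          - ∑ i ∈ Finset.range n, F (i + 1) * Real.sin ((i + 1 - r) * θ)) := by
    simp only [hS, Finset.mul_sum, ← Finset.sum_sub_distrib, ← Finset.sum_add_distrib]
    refine Finset.sum_congr rfl fun i _ ↦ ?_
    have h1 : Real.sin ((i + 1 + r) * θ) = Real.sin ((i + 1) * θ) * Real.cos (r * θ)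
        + Real.cos ((i + 1) * θ) * Real.sin (r * θ) := by
      rw [← Real.sin_add]; ring_nf
    have h2 : Real.sin ((i + 1 - r) * θ) = Real.sin ((i + 1) * θ) * Real.cos (r * θ)
        - Real.cos ((i + 1) * θ) * Real.sin (r * θ) := by
      rw [← Real.sin_sub]; ring_nf
    rw [h1, h2]
    ring
  push_cast at hR hL'
  simp only [add_sub_cancel_right] at hR hL'
  have hmain : |S| ≤ n * (L * (r / N) ^ α) + 2 * r * B := by
    have h1 : 2 * |S| ≤ |2 * (1 - Real.cos (r * θ)) * S| := by
      rw [abs_mul, abs_of_nonneg (by linarith : 0 ≤ 2 * (1 - Real.cos (r * θ)))]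
      have := abs_nonneg S
      nlinarith
    rw [hid] at h1
    have h2 := abs_le.mp hR
    have h3 := abs_le.mp hL'
    have h4 := abs_le.mp hdiff
    have h5 : 2 * |S| ≤ n * (2 * (L * (r / N) ^ α)) + 2 * r * B + 2 * r * B :=
      h1.trans (abs_le.mpr ⟨by linarith, by linarith⟩)
    linarith
  have hp : ((j : ℝ) + 1)⁻¹ ≤ ((j : ℝ) + 1) ^ (-α) := by
    rw [← Real.rpow_neg_one]
    exact Real.rpow_le_rpow_of_exponent_le (by linarith) (by linarith)
  have h5 : ((r : ℝ) / N) ^ α ≤ 2 * ((j : ℝ) + 1) ^ (-α) := by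
    calc ((r : ℝ) / N) ^ α ≤ (2 * ((j : ℝ) + 1)⁻¹) ^ α := by
          gcongr
          rw [div_le_iff₀ hN0]
          calc (r : ℝ) ≤ _ := hr3
            _ = _ := by field_simp
      _ = 2 ^ α * ((j : ℝ) + 1) ^ (-α) := by
          rw [Real.mul_rpow (by positivity) (by positivity), Real.inv_rpow (by positivity),
            Real.rpow_neg (by positivity)]
      _ ≤ 2 * ((j : ℝ) + 1) ^ (-α) := by
          gcongr
          calc (2 : ℝ) ^ α ≤ 2 ^ (1 : ℝ) := Real.rpow_le_rpow_of_exponent_le (by norm_num) hα1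
            _ = 2 := Real.rpow_one 2
  have h6 : (r : ℝ) ≤ 2 * N * ((j : ℝ) + 1) ^ (-α) := by
    calc (r : ℝ) ≤ 2 * N * ((j : ℝ) + 1)⁻¹ := hr3.trans (le_of_eq (by field_simp))
      _ ≤ _ := by gcongr
  calc |S| ≤ n * (L * (r / N) ^ α) + 2 * r * B := hmain
    _ ≤ N * (L * (2 * ((j : ℝ) + 1) ^ (-α))) + 2 * (2 * N * ((j : ℝ) + 1) ^ (-α)) * B := by
        have hnN : (n : ℝ) ≤ N := by rw [hN]; linarith
        gcongr
    _ = _ := by ring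

end SineCoefficients

/-! ### Spectrum of the Brownian kernel matrix -/

section BrownianKernel

variable {n : ℕ}

/-- The vector `∑ j, min i (j + 1) * z j`, as a function of `i : ℕ`: up to a factor the Brownian
kernel matrix applied to `z`, extended to the boundary point `0` and the ghost point `n + 1`. The
index `j : Fin n` stands for the design point `x_{j+1}`, so row `i : Fin n` of the matrix is the
value at `i + 1`. -/
noncomputable def minSum (z : Fin n → ℝ) (i : ℕ) : ℝ := ∑ j : Fin n, min (i : ℝ) ((j : ℝ) + 1) * z j

lemma minSum_zero (z : Fin n → ℝ) : minSum z 0 = 0 := by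
  refine Finset.sum_eq_zero fun j _ ↦ ?_
  rw [Nat.cast_zero, min_eq_left (by positivity), zero_mul]

lemma minSum_ghost (z : Fin n → ℝ) : minSum z (n + 1) = minSum z n := by
  refine Finset.sum_congr rfl fun j _ ↦ ?_
  have : (j : ℝ) + 1 ≤ n := by exact_mod_cast j.2
  rw [min_eq_right (by push_cast; linarith), min_eq_right this]

/-- The Brownian kernel matrix is the Green matrix of the discrete Laplacian. -/
lemma minSum_second_difference (z : Fin n → ℝ) {i : ℕ} (hi : i < n) :
    2 * minSum z (i + 1) - minSum z i - minSum z (i + 2) = z ⟨i, hi⟩ := by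
  simp only [minSum, Finset.mul_sum, ← Finset.sum_sub_distrib]
  rw [Finset.sum_eq_single ⟨i, hi⟩]
  · push_cast
    rw [min_eq_left (by linarith), min_eq_left (by linarith), min_eq_right (by linarith)]
    ring
  · intro j _ hj
    have hne : (j : ℕ) ≠ i := fun h ↦ hj (Fin.ext h)
    push_cast
    rcases lt_or_gt_of_ne hne with h | h
    · have : (j : ℝ) + 1 ≤ i := by exact_mod_cast h
      rw [min_eq_right (by linarith), min_eq_right (by linarith), min_eq_right (by linarith)]
      ring
    · have : (i : ℝ) + 1 ≤ j := by exact_mod_cast h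
      rw [min_eq_left (by linarith), min_eq_left (by linarith), min_eq_left (by linarith)]
      ring
  · simp

/-- The discrete Laplacian with mixed boundary conditions is injective. -/
lemma eq_zero_of_second_difference {H : ℕ → ℝ} (h0 : H 0 = 0) (hn : H (n + 1) = H n)
    (hH : ∀ i < n, 2 * H (i + 1) - H i - H (i + 2) = 0) {i : ℕ} (hi : i ≤ n) : H i = 0 := by
  have hd : ∀ i ≤ n, H (i + 1) - H i = H 1 - H 0 := by
    intro i
    induction i with
    | zero => intro _; rfl
    | succ i ih => intro hi; linarith [ih (by omega), hH i (by omega)]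
  have h1 : H 1 - H 0 = 0 := by rw [← hd n le_rfl, hn, sub_self]
  induction i with
  | zero => exact h0
  | succ i ih => linarith [ih (by omega), hd i (by omega)]

/-- The frequency `θ_j = (j + 1/2) π / (n + 1/2)`, `j = 0, …, n - 1`. -/
noncomputable def sineFreq (n j : ℕ) : ℝ := (j + 1 / 2) * Real.pi / (n + 1 / 2)

/-- The unnormalised eigenvector `sin ((i + 1) θ_j)`, `i = 0, …, n - 1`. -/
noncomputable def sineVec (n j : ℕ) : Fin n → ℝ := fun i ↦ Real.sin (((i : ℝ) + 1) * sineFreq n j)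

lemma sineFreq_pos (n j : ℕ) : 0 < sineFreq n j := by
  unfold sineFreq
  have := Real.pi_pos
  positivity

lemma sineFreq_lt_pi {j : ℕ} (hj : j < n) : sineFreq n j < Real.pi := by
  have h : (j : ℝ) < n := by exact_mod_cast hj
  rw [sineFreq, div_lt_iff₀ (by positivity), mul_comm]
  have := Real.pi_pos
  gcongr

/-- The eigenvalue `2 - 2 cos θ_j` of the discrete Laplacian is at least `((j + 1) / N) ^ 2`. -/
lemma sq_le_two_sub_two_mul_cos {j : ℕ} (hj : j < n) :
    (((j : ℝ) + 1) / (n + 1 / 2)) ^ 2 ≤ 2 - 2 * Real.cos (sineFreq n j) := by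
  set θ := sineFreq n j with hθ
  have h0 := sineFreq_pos n j
  have h1 := sineFreq_lt_pi hj
  have hs : θ / Real.pi ≤ Real.sin (θ / 2) := by
    have := Real.mul_le_sin (x := θ / 2) (by positivity) (by linarith)
    calc θ / Real.pi = 2 / Real.pi * (θ / 2) := by ring
      _ ≤ _ := this
  have hc : 2 - 2 * Real.cos θ = 4 * Real.sin (θ / 2) ^ 2 := by
    have := Real.cos_sq' (θ / 2)
    have h2 := Real.cos_two_mul (θ / 2)
    rw [show 2 * (θ / 2) = θ by ring] at h2
    rw [h2, this]; ring
  have hp := Real.pi_pos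
  have hle : ((j : ℝ) + 1) / (n + 1 / 2) ≤ 2 * (θ / Real.pi) := by
    rw [hθ, sineFreq]
    calc ((j : ℝ) + 1) / (n + 1 / 2) ≤ (2 * (j + 1 / 2)) / (n + 1 / 2) := by
          gcongr
          have : (0 : ℝ) ≤ j := by positivity
          linarith
      _ = _ := by field_simp
  rw [hc]
  calc (((j : ℝ) + 1) / (n + 1 / 2)) ^ 2 ≤ (2 * Real.sin (θ / 2)) ^ 2 := by
        gcongr
        exact hle.trans (by linarith)
    _ = _ := by ring

lemma two_sub_two_mul_cos_pos {j : ℕ} (hj : j < n) : 0 < 2 - 2 * Real.cos (sineFreq n j) :=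
  lt_of_lt_of_le (by positivity) (sq_le_two_sub_two_mul_cos hj)

/-- The Neumann condition: `sin (i θ_j)` is even about `i = n + 1/2`. -/
lemma sin_sineFreq_ghost (n j : ℕ) :
    Real.sin (((n + 1 : ℕ) : ℝ) * sineFreq n j) = Real.sin ((n : ℝ) * sineFreq n j) := by
  have h : ((n + 1 : ℕ) : ℝ) * sineFreq n j
      = (Real.pi - (n : ℝ) * sineFreq n j) + j * (2 * Real.pi) := by
    rw [sineFreq]; push_cast; field_simp; ring
  rw [h, Real.sin_add_nat_mul_two_pi, Real.sin_pi_sub]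

lemma minSum_sineVec {j : ℕ} (hj : j < n) {i : ℕ} (hi : i ≤ n) :
    minSum (sineVec n j) i
      = (2 - 2 * Real.cos (sineFreq n j))⁻¹ * Real.sin (i * sineFreq n j) := by
  have hpos := two_sub_two_mul_cos_pos hj
  set θ := sineFreq n j with hθ
  have := eq_zero_of_second_difference (n := n)
    (H := fun i ↦ minSum (sineVec n j) i - (2 - 2 * Real.cos θ)⁻¹ * Real.sin (i * θ))
    (by simp [minSum_zero]) (by simp only [minSum_ghost, hθ, sin_sineFreq_ghost])
    (fun i hi ↦ by
      have h1 := minSum_second_difference (sineVec n j) hi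
      have h2 : 2 * Real.sin ((i + 1 : ℕ) * θ) - Real.sin (i * θ) - Real.sin ((i + 2 : ℕ) * θ)
          = (2 - 2 * Real.cos θ) * Real.sin ((i + 1 : ℕ) * θ) := by
        have e1 : (i : ℝ) * θ = (i + 1 : ℕ) * θ - θ := by push_cast; ring
        have e2 : ((i + 2 : ℕ) : ℝ) * θ = (i + 1 : ℕ) * θ + θ := by push_cast; ring
        rw [e1, e2, Real.sin_add, Real.sin_sub]; ring
      have h3 : sineVec n j ⟨i, hi⟩ = Real.sin ((i + 1 : ℕ) * θ) := by
        simp [sineVec, hθ]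
      rw [h3] at h1
      have h4 : (2 - 2 * Real.cos θ)⁻¹ * (2 * Real.sin ((i + 1 : ℕ) * θ) - Real.sin (i * θ)
          - Real.sin ((i + 2 : ℕ) * θ)) = Real.sin ((i + 1 : ℕ) * θ) := by
        rw [h2, inv_mul_cancel_left₀ hpos.ne']
      linarith) hi
  exact sub_eq_zero.mp this

lemma sineVec_dotProduct_self {j : ℕ} (hj : j < n) :
    sineVec n j ⬝ᵥ sineVec n j = (n + 1 / 2) / 2 := by
  set θ := sineFreq n j with hθ
  have hs : 0 < Real.sin θ := Real.sin_pos_of_pos_of_lt_pi (sineFreq_pos n j) (sineFreq_lt_pi hj)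
  -- The sum of `cos (2 (i + 1) θ)` telescopes after multiplication by `2 sin θ`.
  have htel : ∀ l : ℕ, ∑ i ∈ Finset.range l, 2 * Real.sin θ * Real.cos (2 * ((i + 1) * θ))
      = Real.sin ((2 * l + 1) * θ) - Real.sin θ := by
    intro l
    induction l with
    | zero => simp
    | succ l ih =>
      rw [Finset.sum_range_succ, ih]
      have e1 : (2 * ((l + 1 : ℕ) : ℝ) + 1) * θ = 2 * ((l + 1) * θ) + θ := by push_cast; ring
      have e2 : (2 * (l : ℝ) + 1) * θ = 2 * ((l + 1) * θ) - θ := by ring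
      rw [e1, e2, Real.sin_add, Real.sin_sub]; ring
  have hend : Real.sin ((2 * n + 1) * θ) = 0 := by
    have : (2 * n + 1) * θ = ((2 * j + 1 : ℕ) : ℝ) * Real.pi := by
      rw [hθ, sineFreq]; push_cast; field_simp
    rw [this, Real.sin_nat_mul_pi]
  have hcos : ∑ i ∈ Finset.range n, Real.cos (2 * ((i + 1) * θ)) = -(1 / 2) := by
    have h := htel n
    rw [hend, ← Finset.mul_sum] at h
    have : Real.sin θ * (2 * ∑ i ∈ Finset.range n, Real.cos (2 * ((i + 1) * θ)) + 1) = 0 := by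
      linarith
    rcases mul_eq_zero.mp this with h | h
    · exact absurd h hs.ne'
    · linarith
  have : sineVec n j ⬝ᵥ sineVec n j
      = ∑ i ∈ Finset.range n, (1 / 2 - Real.cos (2 * ((i + 1) * θ)) / 2) := by
    rw [dotProduct, ← Fin.sum_univ_eq_sum_range
      (fun i ↦ (1 / 2 - Real.cos (2 * ((i + 1) * θ)) / 2)) n]
    refine Finset.sum_congr rfl fun i _ ↦ ?_
    rw [← Real.sin_sq_eq_half_sub, sineVec, sq]
  rw [this, Finset.sum_sub_distrib, ← Finset.sum_div, ← Finset.sum_div, hcos]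
  simp
  ring

variable {c : ℝ} {k : unitInterval → unitInterval → ℝ}

lemma kernelMatrix_mulVec (hk : ∀ s t : unitInterval, k s t = c * min (s : ℝ) (t : ℝ))
    (z : Fin n → ℝ) (i : Fin n) :
    (kernelMatrix k (designPoint n) *ᵥ z) i = c / (n + 1 / 2) * minSum z (i + 1) := by
  simp only [mulVec, dotProduct, kernelMatrix, Matrix.of_apply, minSum, Finset.mul_sum, hk,
    designPoint]
  refine Finset.sum_congr rfl fun j _ ↦ ?_
  rw [min_div_div_right (by positivity)]
  push_cast
  ring

lemma kernelMatrix_transpose (hk : ∀ s t : unitInterval, k s t = c * min (s : ℝ) (t : ℝ)) :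
    (kernelMatrix k (designPoint n))ᵀ = kernelMatrix k (designPoint n) := by
  ext i j
  simp [kernelMatrix, hk, min_comm]

/-- The eigenvalues of the kernel matrix, in decreasing order. -/
noncomputable def sineEigenvalue (c : ℝ) (n j : ℕ) : ℝ :=
  c / (n + 1 / 2) * (2 - 2 * Real.cos (sineFreq n j))⁻¹

lemma kernelMatrix_mulVec_sineVec (hk : ∀ s t : unitInterval, k s t = c * min (s : ℝ) (t : ℝ))
    {j : ℕ} (hj : j < n) :
    kernelMatrix k (designPoint n) *ᵥ sineVec n j = sineEigenvalue c n j • sineVec n j := by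
  ext i
  rw [kernelMatrix_mulVec hk, minSum_sineVec hj (by omega)]
  simp [sineVec, sineEigenvalue, mul_assoc]

lemma sineEigenvalue_pos (hc : 0 < c) {j : ℕ} (hj : j < n) : 0 < sineEigenvalue c n j :=
  mul_pos (by positivity) (inv_pos.mpr (two_sub_two_mul_cos_pos hj))

lemma sineEigenvalue_le (hc : 0 < c) {j : ℕ} (hj : j < n) :
    sineEigenvalue c n j ≤ c * (n + 1 / 2) / ((j : ℝ) + 1) ^ 2 := by
  calc sineEigenvalue c n j ≤ c / (n + 1 / 2) * ((((j : ℝ) + 1) / (n + 1 / 2)) ^ 2)⁻¹ := by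
        rw [sineEigenvalue]
        gcongr
        exact sq_le_two_sub_two_mul_cos hj
    _ = _ := by field_simp

lemma sineEigenvalue_lt (hc : 0 < c) {i j : ℕ} (hij : i < j) (hj : j < n) :
    sineEigenvalue c n j < sineEigenvalue c n i := by
  have h1 : sineFreq n i < sineFreq n j := by
    have : (i : ℝ) < j := by exact_mod_cast hij
    have := Real.pi_pos
    unfold sineFreq
    gcongr
  have h2 := Real.cos_lt_cos_of_nonneg_of_le_pi (sineFreq_pos n i).le (sineFreq_lt_pi hj).le h1
  have h3 := two_sub_two_mul_cos_pos (hij.trans hj)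
  unfold sineEigenvalue
  gcongr

/-- Eigenvectors of the symmetric kernel matrix for different eigenvalues are orthogonal. -/
lemma IsSortedEigenbasis.sineVec_dotProduct_eq_zero {μ : Fin n → ℝ} {v : Fin n → Fin n → ℝ}
    (hk : ∀ s t : unitInterval, k s t = c * min (s : ℝ) (t : ℝ))
    (hv : IsSortedEigenbasis (kernelMatrix k (designPoint n)) μ v) {j l : Fin n}
    (hne : μ j ≠ sineEigenvalue c n l) : sineVec n l ⬝ᵥ v j = 0 := by
  have h := congrArg (fun z ↦ z ⬝ᵥ v j) (kernelMatrix_mulVec_sineVec hk l.2)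
  simp only [smul_dotProduct, smul_eq_mul] at h
  rw [hv.mulVec_dotProduct (kernelMatrix_transpose hk)] at h
  have h' : (μ j - sineEigenvalue c n l) * (sineVec n l ⬝ᵥ v j) = 0 := by linarith
  exact (mul_eq_zero.mp h').resolve_left (sub_ne_zero.mpr hne)

/-- Any sorted orthonormal eigenbasis of the kernel matrix has the sine eigenvalues: these are
`n` distinct eigenvalues, so both decreasing lists exhaust the spectrum. -/
lemma IsSortedEigenbasis.eigenvalue_eq {μ : Fin n → ℝ} {v : Fin n → Fin n → ℝ}
    (hk : ∀ s t : unitInterval, k s t = c * min (s : ℝ) (t : ℝ)) (hc : 0 < c)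
    (hv : IsSortedEigenbasis (kernelMatrix k (designPoint n)) μ v) (l : Fin n) :
    μ l = sineEigenvalue c n l := by
  have hex : ∀ l : Fin n, ∃ j, μ j = sineEigenvalue c n l := by
    intro l
    by_contra! hne
    have hzero : ∀ j, sineVec n l ⬝ᵥ v j = 0 := fun j ↦
      hv.sineVec_dotProduct_eq_zero hk (hne j)
    have h1 := hv.parseval (sineVec n l) (sineVec n l)
    rw [sineVec_dotProduct_self l.2] at h1
    simp only [hzero, zero_mul, Finset.sum_const_zero] at h1
    have : (0 : ℝ) < (n + 1 / 2) / 2 := by positivity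
    linarith
  choose τ hτ using hex
  -- `τ` is strictly increasing on `Fin n`, hence the identity.
  have hmono : StrictMono τ := by
    intro a b hab
    by_contra! h
    have h1 := hv.antitone h
    rw [hτ, hτ] at h1
    exact absurd (sineEigenvalue_lt hc hab b.2) (not_lt.mpr h1)
  have hid : τ l = l := by
    have := Subsingleton.elim (hmono.orderIsoOfSurjective τ
      (Finite.surjective_of_injective hmono.injective)) (OrderIso.refl _)
    exact congrArg (fun e : Fin n ≃o Fin n ↦ e l) this
  rw [← hτ l, hid]

/-- The eigenvectors agree with the normalised sine vectors up to sign; the sign cancels in the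
spectral projections. -/
lemma IsSortedEigenbasis.projection_eq {μ : Fin n → ℝ} {v : Fin n → Fin n → ℝ}
    (hk : ∀ s t : unitInterval, k s t = c * min (s : ℝ) (t : ℝ)) (hc : 0 < c)
    (hv : IsSortedEigenbasis (kernelMatrix k (designPoint n)) μ v) (l : Fin n)
    (a b : Fin n → ℝ) :
    (a ⬝ᵥ v l) * (v l ⬝ᵥ b)
      = 2 / (n + 1 / 2) * ((a ⬝ᵥ sineVec n l) * (sineVec n l ⬝ᵥ b)) := by
  have hzero : ∀ j, j ≠ l → sineVec n l ⬝ᵥ v j = 0 := by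
    intro j hj
    have hne : μ j ≠ sineEigenvalue c n l := by
      rw [hv.eigenvalue_eq hk hc]
      rcases lt_or_gt_of_ne hj with h | h
      · exact (sineEigenvalue_lt hc h l.2).ne'
      · exact (sineEigenvalue_lt hc h j.2).ne
    exact hv.sineVec_dotProduct_eq_zero hk hne
  have hexp : ∀ b, sineVec n l ⬝ᵥ b = (sineVec n l ⬝ᵥ v l) * (v l ⬝ᵥ b) := by
    intro b
    rw [← hv.parseval, Finset.sum_eq_single l]
    · intro j _ hj; rw [hzero j hj, zero_mul]
    · simp
  have hnorm : (sineVec n l ⬝ᵥ v l) ^ 2 = (n + 1 / 2) / 2 := by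
    rw [← sineVec_dotProduct_self l.2, hexp (sineVec n l), dotProduct_comm (v l), sq]
  rw [dotProduct_comm a (sineVec n l), hexp a, hexp b, dotProduct_comm a]
  have : 2 / ((n : ℝ) + 1 / 2) * (sineVec n l ⬝ᵥ v l) ^ 2 = 1 := by rw [hnorm]; field_simp
  linear_combination (-(v l ⬝ᵥ a) * (v l ⬝ᵥ b)) * this

end BrownianKernel

/-! ### Interpolation between design points -/

section Interpolation

variable {n : ℕ}

/-- The weights of linear interpolation between the design points with indices `a` and `a + 1`
(counted from `0`, so at positions `(a + 1) / N` and `(a + 2) / N`). -/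
noncomputable def interpWeights (n a : ℕ) (t : ℝ) : Fin n → ℝ :=
  fun i ↦ if (i : ℕ) = a then 1 - t else if (i : ℕ) = a + 1 then t else 0

lemma interpWeights_dotProduct {a : ℕ} (ha : a + 1 < n) (t : ℝ) (z : Fin n → ℝ) :
    interpWeights n a t ⬝ᵥ z = (1 - t) * z ⟨a, by omega⟩ + t * z ⟨a + 1, ha⟩ := by
  rw [dotProduct, ← Finset.sum_subset (Finset.subset_univ {⟨a, by omega⟩, ⟨a + 1, ha⟩}),
    Finset.sum_pair (by simp)]
  · simp [interpWeights]
  · intro i _ hi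
    simp only [Finset.mem_insert, Finset.mem_singleton, not_or, Fin.ext_iff] at hi
    simp [interpWeights, hi.1, hi.2]

/-- Between two design points the Brownian kernel is interpolated linearly, up to the variance of
a Brownian bridge on the diagonal. -/
lemma exists_interpolation {c : ℝ} (hc : 0 ≤ c) {k : unitInterval → unitInterval → ℝ}
    (hk : ∀ s t : unitInterval, k s t = c * min (s : ℝ) (t : ℝ)) (x : unitInterval)
    (h1 : 2 ≤ ((n : ℝ) + 1 / 2) * x) (h2 : ((n : ℝ) + 1 / 2) * x < n) :
    ∃ (a : ℕ) (t : ℝ), a + 1 < n ∧ 0 ≤ t ∧ t ≤ 1 ∧ ((n : ℝ) + 1 / 2) * x = a + 1 + t ∧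
      kernelVec k (designPoint n) x
        = kernelMatrix k (designPoint n) *ᵥ interpWeights n a t ∧
      k x x ≤ interpWeights n a t ⬝ᵥ (kernelMatrix k (designPoint n) *ᵥ interpWeights n a t)
        + c / (n + 1 / 2) := by
  set N : ℝ := (n : ℝ) + 1 / 2 with hN
  have hN0 : 0 < N := by positivity
  have hfl : ⌊N * x⌋₊ ≠ 0 := by
    have := Nat.le_floor (n := 2) (a := N * x) (by exact_mod_cast h1)
    omega
  obtain ⟨a, ha⟩ := Nat.exists_eq_succ_of_ne_zero hfl
  have hle : ((a + 1 : ℕ) : ℝ) ≤ N * x := by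
    have := Nat.floor_le (a := N * x) (by linarith)
    rwa [ha] at this
  have hlt : N * x < (a + 1 : ℕ) + 1 := by
    have := Nat.lt_floor_add_one (N * x)
    rwa [ha] at this
  push_cast at hle hlt
  have han : a + 1 < n := by
    have : ((a + 1 : ℕ) : ℝ) < n := by push_cast; linarith
    exact_mod_cast this
  have hx : (x : ℝ) = N * x / N := by field_simp
  have ht0 : 0 ≤ N * x - (a + 1) := by linarith
  have ht1 : N * x - (a + 1) ≤ 1 := by linarith
  set t : ℝ := N * x - (a + 1) with ht
  have hvec : kernelVec k (designPoint n) x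
      = kernelMatrix k (designPoint n) *ᵥ interpWeights n a t := by
    ext j
    have e : (kernelMatrix k (designPoint n) *ᵥ interpWeights n a t) j
        = interpWeights n a t ⬝ᵥ fun i ↦ k (designPoint n j) (designPoint n i) := by
      rw [dotProduct_comm]; rfl
    rw [e, interpWeights_dotProduct han]
    simp only [kernelVec, hk, designPoint, ← hN]
    rw [hx, min_div_div_right hN0.le, min_div_div_right hN0.le, min_div_div_right hN0.le]
    push_cast
    rcases le_or_gt (j : ℕ) a with h | h
    · have h' : (j : ℝ) ≤ a := by exact_mod_cast h
      rw [min_eq_right (by linarith), min_eq_left (by linarith), min_eq_left (by linarith)]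
      ring
    · have h' : (a : ℝ) + 1 ≤ j := by exact_mod_cast h
      rw [min_eq_left (by linarith), min_eq_right (by linarith), min_eq_right (by linarith), ht]
      ring
  refine ⟨a, t, han, ht0, ht1, by rw [ht]; ring, hvec, ?_⟩
  rw [← hvec, interpWeights_dotProduct han]
  simp only [kernelVec, hk, designPoint, ← hN]
  rw [hx, min_div_div_right hN0.le, min_div_div_right hN0.le, min_div_div_right hN0.le, min_self]
  push_cast
  rw [min_eq_right (by linarith), min_eq_left (by linarith)]
  have e : N * x = a + 1 + t := by rw [ht]; ring
  rw [e]
  have h3 : 0 ≤ c / N := by positivity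
  have h4 : (1 - t) * (c * ((a + 1) / N)) + t * (c * ((a + 1 + t) / N)) + c / N
      - c * ((a + 1 + t) / N) = c / N * (1 - t + t ^ 2) := by ring
  have h5 : 0 ≤ c / N * (1 - t + t ^ 2) := by
    apply mul_nonneg h3; nlinarith
  linarith

lemma abs_interpWeights_dotProduct_le {a : ℕ} (ha : a + 1 < n) {t : ℝ} (ht0 : 0 ≤ t)
    (ht1 : t ≤ 1) {z : Fin n → ℝ} {y E : ℝ} (h1 : |z ⟨a, by omega⟩ - y| ≤ E)
    (h2 : |z ⟨a + 1, ha⟩ - y| ≤ E) : |interpWeights n a t ⬝ᵥ z - y| ≤ E := by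
  rw [interpWeights_dotProduct ha]
  rw [abs_le] at *
  constructor <;> nlinarith

end Interpolation

/-! ### Sums over the spectrum -/

section Sums

/-- The effective number of degrees of freedom is of the order of the cutoff `J`. -/
lemma sum_min_one_le {n : ℕ} {J : ℝ} (hJ : 1 ≤ J) :
    ∑ j : Fin n, min 1 (J ^ 2 / ((j : ℝ) + 1) ^ 2) ≤ 3 * J := by
  have h := Fin.sum_univ_eq_sum_range (fun j ↦ min 1 (J ^ 2 / ((j : ℝ) + 1) ^ 2)) n
  rw [h]
  have hnn : ∀ j : ℕ, 0 ≤ min 1 (J ^ 2 / ((j : ℝ) + 1) ^ 2) := fun j ↦ by positivity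
  set A := ⌈J⌉₊ with hA
  have hA1 : J ≤ A := Nat.le_ceil J
  have hA2 : (A : ℝ) < J + 1 := Nat.ceil_lt_add_one (by linarith)
  have hA0 : A ≠ 0 := by
    intro h0; rw [h0] at hA1; norm_num at hA1; linarith
  calc ∑ j ∈ Finset.range n, min 1 (J ^ 2 / ((j : ℝ) + 1) ^ 2)
      ≤ ∑ j ∈ Finset.range (A + n), min 1 (J ^ 2 / ((j : ℝ) + 1) ^ 2) :=
        Finset.sum_le_sum_of_subset_of_nonneg (by simp) fun j _ _ ↦ hnn j
    _ = ∑ j ∈ Finset.range A, min 1 (J ^ 2 / ((j : ℝ) + 1) ^ 2)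
        + ∑ j ∈ Finset.Ico A (A + n), min 1 (J ^ 2 / ((j : ℝ) + 1) ^ 2) :=
        (Finset.sum_range_add_sum_Ico _ (by omega)).symm
    _ ≤ ∑ j ∈ Finset.range A, 1 + ∑ j ∈ Finset.Ico A (A + n), J ^ 2 / ((j : ℝ) + 1) ^ 2 := by
        gcongr
        · exact min_le_left _ _
        · exact min_le_right _ _
    _ = A + J ^ 2 * ∑ j ∈ Finset.Ioc A (A + n), ((j : ℝ) ^ 2)⁻¹ := by
        have : ∑ j ∈ Finset.Ico A (A + n), J ^ 2 / ((j : ℝ) + 1) ^ 2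
            = ∑ j ∈ Finset.Ico (A + 1) (A + n + 1), J ^ 2 / (j : ℝ) ^ 2 := by
          rw [← Finset.sum_Ico_add' (fun j : ℕ ↦ J ^ 2 / (j : ℝ) ^ 2)]
          push_cast; rfl
        rw [this, Finset.mul_sum, Finset.sum_const, Finset.card_range, nsmul_eq_mul, mul_one]
        congr 1
        exact Finset.sum_congr (by ext; simp) fun j _ ↦ div_eq_mul_inv _ _
    _ ≤ (J + 1) + J ^ 2 * J⁻¹ := by
        gcongr
        refine (sum_Ioc_inv_sq_le_sub hA0 (by omega)).trans ?_
        have h1 : (A : ℝ)⁻¹ ≤ J⁻¹ := by gcongr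
        have h2 : (0 : ℝ) ≤ ((A + n : ℕ) : ℝ)⁻¹ := by positivity
        linarith
    _ ≤ 3 * J := by
        have : J ^ 2 * J⁻¹ = J := by field_simp
        linarith

/-- The tail `∑ (j + 1)⁻²` over the discarded eigendirections `m ≤ j < n`. -/
noncomputable def tailSum (n m : ℕ) : ℝ := ∑ j : Fin n with ¬ j.val < m, (((j : ℝ) + 1) ^ 2)⁻¹

lemma tailSum_self (n : ℕ) : tailSum n n = 0 := by simp [tailSum]

lemma tailSum_nonneg (n m : ℕ) : 0 ≤ tailSum n m := Finset.sum_nonneg fun j _ ↦ by positivity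

lemma tailSum_le {n m : ℕ} (hm : m ≠ 0) (hmn : m ≤ n) : tailSum n m ≤ (m : ℝ)⁻¹ := by
  have h : tailSum n m = ∑ j ∈ Finset.Ioc m n, ((j : ℝ) ^ 2)⁻¹ := by
    rw [tailSum]
    refine Finset.sum_bij (fun j _ ↦ j.val + 1) ?_ ?_ ?_ ?_
    · intro j hj
      simp only [Finset.mem_filter, Finset.mem_univ, true_and, not_lt, Finset.mem_Ioc] at hj ⊢
      omega
    · intro a _ b _ e; exact Fin.ext (by omega)
    · intro b hb
      rw [Finset.mem_Ioc] at hb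
      exact ⟨⟨b - 1, by omega⟩, by simp; omega, by simp; omega⟩
    · intro j _; push_cast; rfl
  rw [h]
  refine (sum_Ioc_inv_sq_le_sub hm hmn).trans ?_
  have : (0 : ℝ) ≤ ((n : ℕ) : ℝ)⁻¹ := by positivity
  linarith

end Sums

/-! ### Variance and bias at a point -/

section Moments

variable {n m : ℕ} {N J c : ℝ} {k : unitInterval → unitInterval → ℝ} {μ : Fin n → ℝ}
  {v : Fin n → Fin n → ℝ}

lemma div_one_add_le_min {s : ℝ} (hs : 0 < s) : s / (1 + s) ≤ min 1 s := by
  refine le_min ?_ ?_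
  · rw [div_le_one (by positivity)]; linarith
  · exact div_le_self hs.le (by linarith)

lemma IsSortedEigenbasis.eigenvalue_pos
    (hk : ∀ s t : unitInterval, k s t = c * min (s : ℝ) (t : ℝ)) (hc : 0 < c)
    (hv : IsSortedEigenbasis (kernelMatrix k (designPoint n)) μ v) (j : Fin n) : 0 < μ j := by
  rw [hv.eigenvalue_eq hk hc]
  exact sineEigenvalue_pos hc j.2

lemma IsSortedEigenbasis.eigenvalue_le (hN : N = n + 1 / 2) (hJ : 0 < J) (hcJ : c = J ^ 2 / N)
    (hk : ∀ s t : unitInterval, k s t = c * min (s : ℝ) (t : ℝ))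
    (hv : IsSortedEigenbasis (kernelMatrix k (designPoint n)) μ v) (j : Fin n) :
    μ j ≤ J ^ 2 / ((j : ℝ) + 1) ^ 2 := by
  have hN0 : 0 < N := by rw [hN]; positivity
  have hc : 0 < c := by rw [hcJ]; positivity
  rw [hv.eigenvalue_eq hk hc]
  refine (sineEigenvalue_le hc j.2).trans (le_of_eq ?_)
  rw [← hN, hcJ, div_mul_cancel₀ _ hN0.ne']

lemma abs_interpWeights_dotProduct_sineVec_le {a : ℕ} (ha : a + 1 < n) {t : ℝ} (ht0 : 0 ≤ t)
    (ht1 : t ≤ 1) (j : ℕ) : |interpWeights n a t ⬝ᵥ sineVec n j| ≤ 1 := by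
  have h : ∀ i, |sineVec n j i - 0| ≤ 1 := fun i ↦ by
    rw [sub_zero]; exact Real.abs_sin_le_one _
  simpa using abs_interpWeights_dotProduct_le ha ht0 ht1 (h _) (h _)

/-- Eigenvectors are delocalised: each carries a share of order `1 / N` of the mass at any
point. -/
lemma IsSortedEigenbasis.sq_interpWeights_dotProduct_le (hN : N = n + 1 / 2) (hc : 0 < c)
    (hk : ∀ s t : unitInterval, k s t = c * min (s : ℝ) (t : ℝ))
    (hv : IsSortedEigenbasis (kernelMatrix k (designPoint n)) μ v)
    {a : ℕ} (ha : a + 1 < n) {t : ℝ} (ht0 : 0 ≤ t) (ht1 : t ≤ 1) (j : Fin n) :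
    (interpWeights n a t ⬝ᵥ v j) ^ 2 ≤ 2 / N := by
  have h := hv.projection_eq hk hc j (interpWeights n a t) (interpWeights n a t)
  rw [dotProduct_comm (v j), dotProduct_comm (sineVec n j), ← sq, ← sq] at h
  have hN0 : 0 < N := by rw [hN]; positivity
  rw [h, ← hN]
  have h1 := abs_interpWeights_dotProduct_sineVec_le ha ht0 ht1 j
  have h2 : (interpWeights n a t ⬝ᵥ sineVec n j) ^ 2 ≤ 1 := (sq_le_one_iff_abs_le_one _).mpr h1
  calc 2 / N * (interpWeights n a t ⬝ᵥ sineVec n j) ^ 2 ≤ 2 / N * 1 := by gcongr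
    _ = _ := mul_one _

/-- The weights of the data in the posterior mean truncated to the first `m` eigendirections, at a
point with kernel vector `κ`. -/
noncomputable def meanWeights (μ : Fin n → ℝ) (v : Fin n → Fin n → ℝ) (m : ℕ) (κ : Fin n → ℝ) :
    Fin n → ℝ :=
  fun i ↦ ∑ j with j.val < m, (κ ⬝ᵥ v j) / (1 + μ j) * v j i

lemma meanWeights_dotProduct (μ : Fin n → ℝ) (v : Fin n → Fin n → ℝ) (m : ℕ) (κ y : Fin n → ℝ) :
    meanWeights μ v m κ ⬝ᵥ y
      = ∑ j with j.val < m, (κ ⬝ᵥ v j) * (v j ⬝ᵥ y) / (1 + μ j) := by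
  simp only [meanWeights, dotProduct, Finset.sum_mul]
  rw [Finset.sum_comm]
  refine Finset.sum_congr rfl fun j _ ↦ ?_
  simp only [Finset.mul_sum, Finset.sum_mul, Finset.sum_div]
  rw [Finset.sum_comm]
  refine Finset.sum_congr rfl fun i _ ↦ ?_
  refine Finset.sum_congr rfl fun l _ ↦ ?_
  ring

/-- Posterior variance at a point, with `m` eigendirections retained: a Brownian bridge term, the
degrees of freedom of the retained directions, and the prior variance of the discarded ones. -/
lemma IsSortedEigenbasis.variance_le (hN : N = n + 1 / 2) (hJ : 1 ≤ J) (hcJ : c = J ^ 2 / N)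
    (hk : ∀ s t : unitInterval, k s t = c * min (s : ℝ) (t : ℝ))
    (hv : IsSortedEigenbasis (kernelMatrix k (designPoint n)) μ v) (m : ℕ)
    {x : unitInterval} {κ : Fin n → ℝ} {a : ℕ} (ha : a + 1 < n) {t : ℝ} (ht0 : 0 ≤ t)
    (ht1 : t ≤ 1)
    (hκ : κ = kernelMatrix k (designPoint n) *ᵥ interpWeights n a t)
    (hkx : k x x ≤ interpWeights n a t ⬝ᵥ κ + c / N) :
    k x x - ∑ j with j.val < m, (κ ⬝ᵥ v j) ^ 2 / (1 + μ j)
      ≤ c / N + 2 / N * (3 * J) + 2 / N * (J ^ 2 * tailSum n m) := by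
  have hN0 : 0 < N := by rw [hN]; positivity
  have hc : 0 < c := by rw [hcJ]; positivity
  have hμ := hv.eigenvalue_pos hk hc
  have hμ' := hv.eigenvalue_le hN (by linarith) hcJ hk
  set w := interpWeights n a t with hw
  have hwv := hv.sq_interpWeights_dotProduct_le hN hc hk ha ht0 ht1
  rw [← hw] at hwv
  have hκv : ∀ j, κ ⬝ᵥ v j = μ j * (w ⬝ᵥ v j) := fun j ↦ by
    rw [hκ, hv.mulVec_dotProduct (kernelMatrix_transpose hk)]
  have hwκ : w ⬝ᵥ κ = ∑ j with j.val < m, μ j * (w ⬝ᵥ v j) ^ 2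
      + ∑ j with ¬ j.val < m, μ j * (w ⬝ᵥ v j) ^ 2 := by
    rw [Finset.sum_filter_add_sum_filter_not, hκ,
      hv.dotProduct_mulVec_eq_sum (kernelMatrix_transpose hk)]
    exact Finset.sum_congr rfl fun j _ ↦ by rw [dotProduct_comm (v j), sq]
  have hhead : ∑ j with j.val < m, μ j * (w ⬝ᵥ v j) ^ 2
      - ∑ j with j.val < m, (κ ⬝ᵥ v j) ^ 2 / (1 + μ j) ≤ 2 / N * (3 * J) := by
    rw [← Finset.sum_sub_distrib]
    calc _ ≤ ∑ j : Fin n with j.val < m, 2 / N * min 1 (J ^ 2 / ((j : ℝ) + 1) ^ 2) := by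
          refine Finset.sum_le_sum fun j _ ↦ ?_
          have h1 := hμ j
          have h2 : μ j * (w ⬝ᵥ v j) ^ 2 - (κ ⬝ᵥ v j) ^ 2 / (1 + μ j)
              = (w ⬝ᵥ v j) ^ 2 * (μ j / (1 + μ j)) := by
            rw [hκv]; field_simp; ring
          rw [h2]
          refine mul_le_mul (hwv j) ?_ (by positivity) (by positivity)
          exact (div_one_add_le_min h1).trans (min_le_min le_rfl (hμ' j))
      _ ≤ ∑ j : Fin n, 2 / N * min 1 (J ^ 2 / ((j : ℝ) + 1) ^ 2) :=
          Finset.sum_le_sum_of_subset_of_nonneg (Finset.filter_subset _ _)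
            fun j _ _ ↦ by positivity
      _ ≤ 2 / N * (3 * J) := by
          rw [← Finset.mul_sum]
          gcongr
          exact sum_min_one_le hJ
  have htail : ∑ j with ¬ j.val < m, μ j * (w ⬝ᵥ v j) ^ 2 ≤ 2 / N * (J ^ 2 * tailSum n m) := by
    rw [tailSum, Finset.mul_sum, Finset.mul_sum]
    refine Finset.sum_le_sum fun j _ ↦ ?_
    rw [mul_comm, ← div_eq_mul_inv]
    exact mul_le_mul (hwv j) (hμ' j) (hμ j).le (by positivity)
  linarith

/-- Variance of the posterior mean at a point. -/
lemma IsSortedEigenbasis.meanWeights_dotProduct_self_le (hN : N = n + 1 / 2) (hJ : 1 ≤ J)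
    (hcJ : c = J ^ 2 / N)
    (hk : ∀ s t : unitInterval, k s t = c * min (s : ℝ) (t : ℝ))
    (hv : IsSortedEigenbasis (kernelMatrix k (designPoint n)) μ v) (m : ℕ)
    {κ : Fin n → ℝ} {a : ℕ} (ha : a + 1 < n) {t : ℝ} (ht0 : 0 ≤ t) (ht1 : t ≤ 1)
    (hκ : κ = kernelMatrix k (designPoint n) *ᵥ interpWeights n a t) :
    meanWeights μ v m κ ⬝ᵥ meanWeights μ v m κ ≤ 2 / N * (3 * J) := by
  have hN0 : 0 < N := by rw [hN]; positivity
  have hc : 0 < c := by rw [hcJ]; positivity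
  have hμ := hv.eigenvalue_pos hk hc
  have hμ' := hv.eigenvalue_le hN (by linarith) hcJ hk
  set w := interpWeights n a t with hw
  have hwv := hv.sq_interpWeights_dotProduct_le hN hc hk ha ht0 ht1
  rw [← hw] at hwv
  have hκv : ∀ j, κ ⬝ᵥ v j = μ j * (w ⬝ᵥ v j) := fun j ↦ by
    rw [hκ, hv.mulVec_dotProduct (kernelMatrix_transpose hk)]
  have hvq : ∀ j : Fin n, j.val < m →
      v j ⬝ᵥ meanWeights μ v m κ = (κ ⬝ᵥ v j) / (1 + μ j) := by
    intro j hj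
    rw [dotProduct_comm, meanWeights_dotProduct, Finset.sum_eq_single j]
    · rw [hv.orthonormal]; simp
    · intro b _ hb; rw [hv.orthonormal, if_neg hb]; simp
    · simp [hj]
  rw [meanWeights_dotProduct]
  calc _ ≤ ∑ j : Fin n with j.val < m, 2 / N * min 1 (J ^ 2 / ((j : ℝ) + 1) ^ 2) := by
        refine Finset.sum_le_sum fun j hj ↦ ?_
        rw [hvq j (Finset.mem_filter.mp hj).2, hκv]
        have h1 := hμ j
        have h2 : μ j * (w ⬝ᵥ v j) * (μ j * (w ⬝ᵥ v j) / (1 + μ j)) / (1 + μ j)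
            = (w ⬝ᵥ v j) ^ 2 * (μ j / (1 + μ j)) ^ 2 := by field_simp
        rw [h2]
        have h3 : μ j / (1 + μ j) ≤ 1 := (div_one_add_le_min h1).trans (min_le_left _ _)
        have h4 : 0 ≤ μ j / (1 + μ j) := by positivity
        refine mul_le_mul (hwv j) ?_ (by positivity) (by positivity)
        calc (μ j / (1 + μ j)) ^ 2 ≤ μ j / (1 + μ j) := by nlinarith
          _ ≤ _ := (div_one_add_le_min h1).trans (min_le_min le_rfl (hμ' j))
    _ ≤ ∑ j : Fin n, 2 / N * min 1 (J ^ 2 / ((j : ℝ) + 1) ^ 2) :=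
        Finset.sum_le_sum_of_subset_of_nonneg (Finset.filter_subset _ _)
          fun j _ _ ↦ by positivity
    _ ≤ 2 / N * (3 * J) := by
        rw [← Finset.mul_sum]
        gcongr
        exact sum_min_one_le hJ

/-- Bias of the full posterior mean at a point, by comparison with the Green function of
`g - a g''`. -/
lemma IsSortedEigenbasis.abs_posterior_bias_le (hN : N = n + 1 / 2) (hJ : 1 ≤ J) (hJN : J ≤ N)
    (hcJ : c = J ^ 2 / N)
    (hk : ∀ s t : unitInterval, k s t = c * min (s : ℝ) (t : ℝ))
    (hv : IsSortedEigenbasis (kernelMatrix k (designPoint n)) μ v)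
    {κ : Fin n → ℝ} {a : ℕ} (ha : a + 1 < n) {t : ℝ} (ht0 : 0 ≤ t) (ht1 : t ≤ 1)
    (hκ : κ = kernelMatrix k (designPoint n) *ᵥ interpWeights n a t)
    {f : ℝ → ℝ} {x L α B : ℝ} (hx0 : 0 ≤ x) (hx : N * x = a + 1 + t)
    (hL : 0 ≤ L) (hα0 : 0 ≤ α) (hα1 : α ≤ 1) (hfL : ∀ s t, |f s - f t| ≤ L * |s - t| ^ α)
    (hfB : ∀ s, |f s| ≤ B) (hBL : B ≤ L * (x / 2) ^ 2) :
    |∑ j, (κ ⬝ᵥ v j) * (v j ⬝ᵥ fun i : Fin n ↦ f (((i : ℝ) + 1) / N)) / (1 + μ j) - f x|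
      ≤ 4 * L * J ^ (-α) := by
  have hN0 : 0 < N := by rw [hN]; positivity
  have hc : 0 < c := by rw [hcJ]; positivity
  have hJ0 : 0 < J := by linarith
  have hμ := hv.eigenvalue_pos hk hc
  set w := interpWeights n a t with hw
  set F : Fin n → ℝ := fun i ↦ f (((i : ℝ) + 1) / N) with hF
  obtain ⟨R, hR, hRs⟩ := hv.exists_resolvent (kernelMatrix_transpose hk) fun j ↦ (hμ j).le
  set z := R *ᵥ F with hz
  have hKz : kernelMatrix k (designPoint n) *ᵥ z + z = F := by
    have h1 : (kernelMatrix k (designPoint n) + (1 : ℝ) • (1 : Matrix (Fin n) (Fin n) ℝ)) *ᵥ z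
        = F := by rw [hz, mulVec_mulVec, hR, one_mulVec]
    rwa [one_smul, add_mulVec, one_mulVec] at h1
  have hsum : ∑ j, (κ ⬝ᵥ v j) * (v j ⬝ᵥ F) / (1 + μ j)
      = w ⬝ᵥ (kernelMatrix k (designPoint n) *ᵥ z) := by
    rw [← hRs κ F, hκ, dotProduct_mulVec w, ← mulVec_transpose, kernelMatrix_transpose hk]
  -- With boundary values added, `g = K z` solves `g - a g'' = f` at the grid points.
  have key : ∀ l : Fin n, a ≤ l.val →
      |(kernelMatrix k (designPoint n) *ᵥ z) l - F l| ≤ 3 * L * J ^ (-α) := by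
    intro l hl
    have h := abs_resolvent_sub_le (n := n) (g := fun i ↦ c / N * minSum z i)
      (f := fun i ↦ f ((i : ℝ) / N)) (N := N) (J := J) (L := L) (α := α) (l := l.val + 1)
      l.2 hN0 hJ hL hα0 (by linarith) (by simp [minSum_zero]) (by simp [minSum_ghost])
      (fun i hi ↦ by
        have h1 := congrFun hKz ⟨i, hi⟩
        have h2 := minSum_second_difference z hi
        rw [Pi.add_apply, kernelMatrix_mulVec hk, ← hN, ← h2] at h1
        simp only [hF] at h1
        push_cast
        rw [← h1, hcJ]
        field_simp)
      (fun i _ ↦ by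
        refine (hfL _ _).trans (le_of_eq ?_)
        rw [← sub_div, abs_div, abs_of_pos hN0])
      (by
        refine (hfB _).trans (hBL.trans ?_)
        have h1 : (a : ℝ) ≤ l := by exact_mod_cast hl
        have h2 : x / 2 ≤ ((l.val + 1 : ℕ) : ℝ) / N := by
          rw [le_div_iff₀ hN0]; push_cast
          linarith
        gcongr)
    rw [kernelMatrix_mulVec hk, ← hN]
    simpa [hF] using h
  have hnear : ∀ l : Fin n, (l : ℕ) = a ∨ (l : ℕ) = a + 1 → |F l - f x| ≤ L * J ^ (-α) := by
    intro l hl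
    have h1 : |((l : ℝ) + 1) / N - x| ≤ J⁻¹ := by
      have e : ((l : ℝ) + 1) / N - x = ((l : ℝ) + 1 - N * x) / N := by field_simp
      have h2 : |(l : ℝ) + 1 - N * x| ≤ 1 := by
        rw [hx, abs_le]
        rcases hl with h | h <;> rw [h] <;> push_cast <;> constructor <;> linarith
      rw [e, abs_div, abs_of_pos hN0]
      calc _ ≤ 1 / N := by gcongr
        _ ≤ 1 / J := by gcongr
        _ = _ := one_div _
    refine (hfL _ _).trans ?_
    rw [Real.rpow_neg hJ0.le, ← Real.inv_rpow hJ0.le]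
    gcongr
  rw [hsum]
  refine abs_interpWeights_dotProduct_le ha ht0 ht1 ?_ ?_
  · have h1 := key ⟨a, by omega⟩ le_rfl
    have h2 := hnear ⟨a, by omega⟩ (Or.inl rfl)
    have h3 := abs_sub_le ((kernelMatrix k (designPoint n) *ᵥ z) ⟨a, by omega⟩)
      (F ⟨a, by omega⟩) (f x)
    linarith
  · have h1 := key ⟨a + 1, ha⟩ (Nat.le_succ a)
    have h2 := hnear ⟨a + 1, ha⟩ (Or.inr rfl)
    have h3 := abs_sub_le ((kernelMatrix k (designPoint n) *ᵥ z) ⟨a + 1, ha⟩)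
      (F ⟨a + 1, ha⟩) (f x)
    linarith

/-- The part of the posterior mean that is lost by discarding the eigendirections `j ≥ m`, for
noiseless data from a Hölder function. -/
lemma IsSortedEigenbasis.abs_tail_bias_le (hN : N = n + 1 / 2) (hJ : 1 ≤ J)
    (hcJ : c = J ^ 2 / N)
    (hk : ∀ s t : unitInterval, k s t = c * min (s : ℝ) (t : ℝ))
    (hv : IsSortedEigenbasis (kernelMatrix k (designPoint n)) μ v) (hm : m ≠ 0)
    {κ : Fin n → ℝ} {a : ℕ} (ha : a + 1 < n) {t : ℝ} (ht0 : 0 ≤ t) (ht1 : t ≤ 1)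
    (hκ : κ = kernelMatrix k (designPoint n) *ᵥ interpWeights n a t)
    {f : ℝ → ℝ} {L α B : ℝ}
    (hL : 0 ≤ L) (hα0 : 0 ≤ α) (hα1 : α ≤ 1) (hfL : ∀ s t, |f s - f t| ≤ L * |s - t| ^ α)
    (hfB : ∀ s, |f s| ≤ B) :
    |∑ j with ¬ j.val < m,
        (κ ⬝ᵥ v j) * (v j ⬝ᵥ fun i : Fin n ↦ f (((i : ℝ) + 1) / N)) / (1 + μ j)|
      ≤ 2 * (2 * L + 4 * B) * (J ^ 2 * (m : ℝ) ^ (-α) * tailSum n m) := by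
  have hN0 : 0 < N := by rw [hN]; positivity
  have hc : 0 < c := by rw [hcJ]; positivity
  have hB0 : 0 ≤ B := (abs_nonneg _).trans (hfB 0)
  have hμ := hv.eigenvalue_pos hk hc
  have hμ' := hv.eigenvalue_le hN (by linarith) hcJ hk
  set w := interpWeights n a t with hw
  set F : Fin n → ℝ := fun i ↦ f (((i : ℝ) + 1) / N) with hF
  have hκv : ∀ j, κ ⬝ᵥ v j = μ j * (w ⬝ᵥ v j) := fun j ↦ by
    rw [hκ, hv.mulVec_dotProduct (kernelMatrix_transpose hk)]
  have hsF : ∀ j : Fin n, |sineVec n j ⬝ᵥ F| ≤ (2 * L + 4 * B) * N * ((j : ℝ) + 1) ^ (-α) := by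
    intro j
    have h := abs_sum_mul_sin_le (F := fun i : ℤ ↦ f (i / N)) (B := B) (L := L) j.2 hN hL hα0
      hα1 (fun i ↦ hfB _) (fun i l ↦ (hfL _ _).trans (le_of_eq (by
        rw [← sub_div, abs_div, abs_of_pos hN0])))
    refine le_trans (le_of_eq ?_) h
    congr 1
    rw [dotProduct, ← Fin.sum_univ_eq_sum_range (fun i ↦ f (((i + 1 : ℤ) : ℝ) / N)
      * Real.sin (((i : ℝ) + 1) * ((((j : ℕ) : ℝ) + 1 / 2) * Real.pi / N)))]
    refine Finset.sum_congr rfl fun i _ ↦ ?_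
    simp only [sineVec, sineFreq, hF, hN]
    push_cast
    ring
  refine (Finset.abs_sum_le_sum_abs _ _).trans ?_
  rw [tailSum, Finset.mul_sum, Finset.mul_sum]
  refine Finset.sum_le_sum fun j hj ↦ ?_
  have hmj : m ≤ (j : ℕ) := not_lt.mp (Finset.mem_filter.mp hj).2
  have hmj' : (m : ℝ) ≤ (j : ℝ) + 1 := by
    have : (m : ℝ) ≤ j := by exact_mod_cast hmj
    linarith
  have hm0 : (0 : ℝ) < m := by exact_mod_cast Nat.pos_of_ne_zero hm
  have h1 := hμ j
  have e : (κ ⬝ᵥ v j) * (v j ⬝ᵥ F) / (1 + μ j)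
      = 2 / N * (μ j / (1 + μ j)) * (w ⬝ᵥ sineVec n j) * (sineVec n j ⬝ᵥ F) := by
    have h2 := hv.projection_eq hk hc j w F
    rw [← hN] at h2
    calc _ = μ j / (1 + μ j) * ((w ⬝ᵥ v j) * (v j ⬝ᵥ F)) := by rw [hκv]; ring
      _ = _ := by rw [h2]; ring
  have h3 : μ j / (1 + μ j) ≤ J ^ 2 / ((j : ℝ) + 1) ^ 2 :=
    ((div_one_add_le_min h1).trans (min_le_right _ _)).trans (hμ' j)
  rw [e, abs_mul, abs_mul, abs_of_nonneg (by positivity : 0 ≤ 2 / N * (μ j / (1 + μ j)))]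
  calc 2 / N * (μ j / (1 + μ j)) * |w ⬝ᵥ sineVec n j| * |sineVec n j ⬝ᵥ F|
      ≤ 2 / N * (J ^ 2 / ((j : ℝ) + 1) ^ 2) * 1
          * ((2 * L + 4 * B) * N * ((j : ℝ) + 1) ^ (-α)) := by
        gcongr
        · exact abs_interpWeights_dotProduct_sineVec_le ha ht0 ht1 j
        · exact hsF j
    _ ≤ 2 / N * (J ^ 2 / ((j : ℝ) + 1) ^ 2) * 1 * ((2 * L + 4 * B) * N * (m : ℝ) ^ (-α)) := by
        have : ((j : ℝ) + 1) ^ (-α) ≤ (m : ℝ) ^ (-α) :=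
          Real.rpow_le_rpow_of_nonpos hm0 hmj' (by linarith)
        gcongr
    _ = _ := by field_simp

end Moments

/-! ### Extension of Hölder functions -/

section HolderExtension

/-- A Hölder function on `[0, 1]`, extended to the line by its end values. -/
lemma IsHolder.exists_extension {α : ℝ} (hα0 : 0 ≤ α) {f₀ : unitInterval → ℝ}
    (h : IsHolder α f₀) :
    ∃ (f : ℝ → ℝ) (L B : ℝ), 0 ≤ L ∧ 0 ≤ B ∧ (∀ s : unitInterval, f s = f₀ s) ∧
      (∀ s t, |f s - f t| ≤ L * |s - t| ^ α) ∧ ∀ s, |f s| ≤ B := by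
  obtain ⟨L, hL⟩ := h
  have hL' : ∀ s t : unitInterval, |f₀ s - f₀ t| ≤ max L 0 * |(s : ℝ) - t| ^ α := fun s t ↦
    (hL s t).trans (by gcongr; exact le_max_left _ _)
  have hB : ∀ s : unitInterval, |f₀ s| ≤ |f₀ 0| + max L 0 := by
    intro s
    have h1 := hL' s 0
    have h2 : |(s : ℝ) - (0 : unitInterval)| ^ α ≤ 1 := by
      refine Real.rpow_le_one (abs_nonneg _) ?_ hα0
      rw [Set.Icc.coe_zero, sub_zero, abs_of_nonneg s.2.1]
      exact s.2.2
    have h3 : max L 0 * |(s : ℝ) - (0 : unitInterval)| ^ α ≤ max L 0 * 1 := by gcongr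
    have h4 := abs_sub_abs_le_abs_sub (f₀ s) (f₀ 0)
    linarith
  refine ⟨fun s ↦ f₀ (Set.projIcc 0 1 zero_le_one s), max L 0, |f₀ 0| + max L 0,
    le_max_right _ _, by positivity, fun s ↦ ?_, fun s t ↦ ?_, fun s ↦ hB _⟩
  · simp only [Set.projIcc_val]
  · refine (hL' _ _).trans (mul_le_mul_of_nonneg_left ?_ (le_max_right _ _))
    exact Real.rpow_le_rpow (abs_nonneg _) (Set.abs_projIcc_sub_projIcc zero_le_one) hα0

end HolderExtension

/-! ### The frequency cutoff and the rates -/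

section Rates

variable {α γ : ℝ} {n m : ℕ}

/-- The frequency cutoff of the rescaled Brownian motion prior: the `j`-th eigenvalue of the kernel
matrix is of order one for `j` near `N ^ (1 / (1 + 2γ))`, and the posterior has the inverse of
this number as bandwidth. -/
noncomputable def cutoff (γ : ℝ) (n : ℕ) : ℝ := ((n : ℝ) + 1 / 2) ^ (1 / (1 + 2 * γ))

lemma one_le_cutoff (hγ : 0 < γ) (hn : n ≠ 0) : 1 ≤ cutoff γ n := by
  have : (1 : ℝ) ≤ n := by exact_mod_cast Nat.one_le_iff_ne_zero.mpr hn
  exact Real.one_le_rpow (by linarith) (by positivity)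

lemma cutoff_pos (γ : ℝ) (n : ℕ) : 0 < cutoff γ n := by
  unfold cutoff; positivity

lemma cutoff_le (hγ : 0 < γ) (hn : n ≠ 0) : cutoff γ n ≤ n + 1 / 2 := by
  have h1 : (1 : ℝ) ≤ n := by exact_mod_cast Nat.one_le_iff_ne_zero.mpr hn
  calc cutoff γ n ≤ ((n : ℝ) + 1 / 2) ^ (1 : ℝ) := by
        refine Real.rpow_le_rpow_of_exponent_le (by linarith) ?_
        rw [div_le_one (by positivity)]; linarith
    _ = _ := Real.rpow_one _

lemma cutoff_rpow (γ : ℝ) (n : ℕ) (e : ℝ) :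
    cutoff γ n ^ e = ((n : ℝ) + 1 / 2) ^ (e / (1 + 2 * γ)) := by
  rw [cutoff, ← Real.rpow_mul (by positivity)]
  congr 1; ring

lemma cutoff_sq_div (hγ : 0 < γ) (n : ℕ) :
    ((n : ℝ) + 1 / 2) ^ ((1 - 2 * γ) / (1 + 2 * γ)) = cutoff γ n ^ 2 / (n + 1 / 2) := by
  have hN : (0 : ℝ) < n + 1 / 2 := by positivity
  rw [← Real.rpow_natCast, cutoff_rpow, ← Real.rpow_sub_one hN.ne']
  congr 1
  push_cast
  field_simp
  ring

lemma cutoff_rpow_neg_le (hα : 0 < α) (hγ : 0 < γ) (hn : n ≠ 0) :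
    cutoff γ n ^ (-α) ≤ (n : ℝ) ^ (-(min α γ / (1 + 2 * γ))) := by
  have h1 : (1 : ℝ) ≤ n := by exact_mod_cast Nat.one_le_iff_ne_zero.mpr hn
  rw [cutoff_rpow, neg_div]
  calc _ ≤ (n : ℝ) ^ (-(α / (1 + 2 * γ))) :=
        Real.rpow_le_rpow_of_nonpos (by linarith) (by linarith)
          (neg_nonpos.mpr (by positivity))
    _ ≤ _ := by
        refine Real.rpow_le_rpow_of_exponent_le h1 ?_
        gcongr
        exact min_le_left _ _

lemma cutoff_div_le (α : ℝ) (hγ : 0 < γ) (hn : n ≠ 0) :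
    cutoff γ n / (n + 1 / 2) ≤ ((n : ℝ) ^ (-(min α γ / (1 + 2 * γ)))) ^ 2 := by
  have h1 : (1 : ℝ) ≤ n := by exact_mod_cast Nat.one_le_iff_ne_zero.mpr hn
  have hN : (0 : ℝ) < n + 1 / 2 := by positivity
  have e : cutoff γ n / (n + 1 / 2) = ((n : ℝ) + 1 / 2) ^ (-(2 * γ / (1 + 2 * γ))) := by
    rw [cutoff, ← Real.rpow_sub_one hN.ne']
    congr 1
    field_simp
    ring
  rw [e, ← Real.rpow_natCast, ← Real.rpow_mul (by positivity)]
  calc _ ≤ (n : ℝ) ^ (-(2 * γ / (1 + 2 * γ))) :=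
        Real.rpow_le_rpow_of_nonpos (by linarith) (by linarith)
          (neg_nonpos.mpr (by positivity))
    _ ≤ _ := by
        refine Real.rpow_le_rpow_of_exponent_le h1 ?_
        have h2 : min α γ / (1 + 2 * γ) ≤ γ / (1 + 2 * γ) := by
          gcongr
          exact min_le_right _ _
        have h3 : 2 * γ / (1 + 2 * γ) = 2 * (γ / (1 + 2 * γ)) := by ring
        push_cast
        linarith

lemma cutoff_sq_le (hγ : 0 < γ) (hn : n ≠ 0) :
    cutoff γ n ^ 2 ≤ 4 * (n : ℝ) ^ (2 / (1 + 2 * γ)) := by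
  have h1 : (1 : ℝ) ≤ n := by exact_mod_cast Nat.one_le_iff_ne_zero.mpr hn
  rw [← Real.rpow_natCast, cutoff_rpow]
  push_cast
  calc ((n : ℝ) + 1 / 2) ^ (2 / (1 + 2 * γ)) ≤ (2 * (n : ℝ)) ^ (2 / (1 + 2 * γ)) := by
        gcongr; linarith
    _ = 2 ^ (2 / (1 + 2 * γ)) * (n : ℝ) ^ (2 / (1 + 2 * γ)) :=
        Real.mul_rpow (by norm_num) (by positivity)
    _ ≤ 2 ^ (2 : ℝ) * (n : ℝ) ^ (2 / (1 + 2 * γ)) := by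
        gcongr
        · norm_num
        · exact div_le_self (by norm_num) (by linarith)
    _ = _ := by norm_num

/-- The excess variance caused by truncation is dominated either by the posterior variance (when
`m ≥ J`) or by the squared truncation bias (when `m ≤ J`). -/
lemma excess_variance_le {J N M : ℝ} (hα1 : α ≤ 1) (hJ : 1 ≤ J) (hM : 1 ≤ M) (hMN : M ≤ N) :
    J ^ 2 * M⁻¹ / N ≤ J / N + (J ^ 2 * M ^ (-(1 + α))) ^ 2 := by
  have hJ0 : 0 < J := by linarith
  have hM0 : 0 < M := by linarith
  have hN0 : 0 < N := by linarith
  rcases le_total J M with h | h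
  · have h1 : J ^ 2 * M⁻¹ ≤ J := by
      rw [← div_eq_mul_inv, div_le_iff₀ hM0]; nlinarith
    have h2 : J ^ 2 * M⁻¹ / N ≤ J / N := by gcongr
    have h3 : 0 ≤ (J ^ 2 * M ^ (-(1 + α))) ^ 2 := by positivity
    linarith
  · have h1 : (M ^ 2)⁻¹ ≤ M ^ (-(1 + α)) := by
      rw [← Real.rpow_natCast, ← Real.rpow_neg hM0.le]
      exact Real.rpow_le_rpow_of_exponent_le hM (by push_cast; linarith)
    have h2 : J ^ 2 * M⁻¹ / N ≤ (J ^ 2 * (M ^ 2)⁻¹) ^ 2 := by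
      calc J ^ 2 * M⁻¹ / N ≤ J ^ 2 * M⁻¹ / M := by gcongr
        _ = J ^ 2 * (M ^ 2)⁻¹ * 1 := by field_simp
        _ ≤ J ^ 2 * (M ^ 2)⁻¹ * (J ^ 2 * (M ^ 2)⁻¹) := by
            gcongr
            rw [← div_eq_mul_inv, one_le_div (by positivity)]
            gcongr
        _ = _ := by ring
    have h3 : (J ^ 2 * (M ^ 2)⁻¹) ^ 2 ≤ (J ^ 2 * M ^ (-(1 + α))) ^ 2 := by gcongr
    have h4 : 0 ≤ J / N := by positivity
    linarith

end Rates

/-! ### Mean squared error at a point -/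

section SecondMoment

/-- Mean squared error of the posterior at `x` with `m` eigendirections retained: posterior variance
plus variance plus squared bias of the posterior mean. -/
lemma IsHolder.exists_second_moment_le {α γ : ℝ} (hα : α ∈ Set.Ioc (0 : ℝ) 1)
    (hγ : γ ∈ Set.Ioc (0 : ℝ) 1) {f₀ : unitInterval → ℝ} (hf₀ : IsHolder α f₀)
    {x : unitInterval} (hx : (x : ℝ) ∈ Set.Ioo (0 : ℝ) 1) :
    ∃ C : ℝ, 0 ≤ C ∧ ∀ᶠ n : ℕ in atTop, ∀ m : ℕ, m ≠ 0 →
      ∀ (μ : Fin n → ℝ) (v : Fin n → Fin n → ℝ),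
      IsSortedEigenbasis (kernelMatrix (rbmKernel γ n) (designPoint n)) μ v →
      rbmKernel γ n x x
          - ∑ j with j.val < m,
              (kernelVec (rbmKernel γ n) (designPoint n) x ⬝ᵥ v j) ^ 2 / (1 + μ j)
        + meanWeights μ v m (kernelVec (rbmKernel γ n) (designPoint n) x)
            ⬝ᵥ meanWeights μ v m (kernelVec (rbmKernel γ n) (designPoint n) x)
        + (meanWeights μ v m (kernelVec (rbmKernel γ n) (designPoint n) x)
            ⬝ᵥ (fun i ↦ f₀ (designPoint n i)) - f₀ x) ^ 2
      ≤ C * (cutoff γ n / (n + 1 / 2) + cutoff γ n ^ 2 * tailSum n m / (n + 1 / 2)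
          + (cutoff γ n ^ (-α) + cutoff γ n ^ 2 * (m : ℝ) ^ (-α) * tailSum n m) ^ 2) := by
  obtain ⟨hα0, hα1⟩ := hα
  obtain ⟨hγ0, -⟩ := hγ
  obtain ⟨hx0, hx1⟩ := hx
  obtain ⟨f, L₀, B, hL₀, hB0, hff, hfL₀, hfB⟩ := hf₀.exists_extension hα0.le
  -- The Hölder constant is enlarged so that the barrier dominates `B` at the Dirichlet end `0`.
  set L : ℝ := L₀ + 4 * B / (x : ℝ) ^ 2 with hLdef
  have hL : 0 ≤ L := by positivity
  have hfL : ∀ s t, |f s - f t| ≤ L * |s - t| ^ α := fun s t ↦ (hfL₀ s t).trans (by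
    gcongr
    rw [hLdef]
    have : 0 ≤ 4 * B / (x : ℝ) ^ 2 := by positivity
    linarith)
  have hBL : B ≤ L * ((x : ℝ) / 2) ^ 2 := by
    have h1 : 4 * B / (x : ℝ) ^ 2 * ((x : ℝ) / 2) ^ 2 = B := by field_simp; ring
    have h2 : 0 ≤ L₀ * ((x : ℝ) / 2) ^ 2 := by positivity
    rw [hLdef, add_mul, h1]
    linarith
  set D : ℝ := 4 * L + 2 * (2 * L + 4 * B) with hD
  refine ⟨13 + D ^ 2, by positivity, ?_⟩
  have ev1 : ∀ᶠ n : ℕ in atTop, 2 / (x : ℝ) ≤ n := tendsto_natCast_atTop_atTop.eventually_ge_atTop _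
  have ev2 : ∀ᶠ n : ℕ in atTop, 1 / (1 - (x : ℝ)) ≤ n :=
    tendsto_natCast_atTop_atTop.eventually_ge_atTop _
  -- From here on `x` lies between the second and the last design point.
  filter_upwards [ev1, ev2, eventually_ne_atTop 0] with n hn1 hn2 hn0 m hm μ v hv
  have h1 : 2 ≤ ((n : ℝ) + 1 / 2) * x := by
    rw [div_le_iff₀ hx0] at hn1
    nlinarith
  have h2 : ((n : ℝ) + 1 / 2) * x < n := by
    rw [div_le_iff₀ (by linarith)] at hn2
    nlinarith
  set N : ℝ := (n : ℝ) + 1 / 2 with hN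
  have hN0 : 0 < N := by positivity
  set J := cutoff γ n with hJdef
  have hJ : 1 ≤ J := one_le_cutoff hγ0 hn0
  have hJN : J ≤ N := cutoff_le hγ0 hn0
  have hk : ∀ s t : unitInterval, rbmKernel γ n s t = J ^ 2 / N * min (s : ℝ) (t : ℝ) :=
    fun s t ↦ by rw [rbmKernel, cutoff_sq_div hγ0]
  have hc : 0 < J ^ 2 / N := by positivity
  obtain ⟨a, t, han, ht0, ht1, hxa, hκ, hkx⟩ := exists_interpolation hc.le hk x h1 h2
  set κ := kernelVec (rbmKernel γ n) (designPoint n) x with hκdef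
  rw [← hκ] at hkx
  have hV := hv.variance_le hN hJ rfl hk m han ht0 ht1 hκ hkx
  have hq := hv.meanWeights_dotProduct_self_le hN hJ rfl hk m han ht0 ht1 hκ
  have hb1 := hv.abs_posterior_bias_le hN hJ hJN rfl hk han ht0 ht1 hκ hx0.le hxa hL hα0.le hα1
    hfL hfB hBL
  have hb2 := hv.abs_tail_bias_le hN hJ rfl hk hm han ht0 ht1 hκ hL hα0.le hα1 hfL hfB
  have hF : (fun i ↦ f₀ (designPoint n i)) = fun i : Fin n ↦ f (((i : ℝ) + 1) / N) := by
    ext i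
    rw [← hff]
    rfl
  have hbias : |meanWeights μ v m κ ⬝ᵥ (fun i ↦ f₀ (designPoint n i)) - f₀ x|
      ≤ D * (J ^ (-α) + J ^ 2 * (m : ℝ) ^ (-α) * tailSum n m) := by
    rw [hF, meanWeights_dotProduct, ← hff x]
    rw [← Finset.sum_filter_add_sum_filter_not Finset.univ (fun j : Fin n ↦ j.val < m)] at hb1
    have h3 : 0 ≤ J ^ (-α) := by positivity
    have h4 : 0 ≤ J ^ 2 * (m : ℝ) ^ (-α) * tailSum n m :=
      mul_nonneg (by positivity) (tailSum_nonneg n m)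
    have h5 : 4 * L * J ^ (-α)
        + 2 * (2 * L + 4 * B) * (J ^ 2 * (m : ℝ) ^ (-α) * tailSum n m)
        ≤ D * (J ^ (-α) + J ^ 2 * (m : ℝ) ^ (-α) * tailSum n m) := by
      have h6 : 0 ≤ 2 * (2 * L + 4 * B) * J ^ (-α) := by positivity
      have h7 : 0 ≤ 4 * L * (J ^ 2 * (m : ℝ) ^ (-α) * tailSum n m) := by positivity
      rw [hD]
      linarith
    refine le_trans ?_ h5
    rw [abs_le] at hb1 hb2 ⊢
    constructor <;> linarith
  have hbias2 : (meanWeights μ v m κ ⬝ᵥ (fun i ↦ f₀ (designPoint n i)) - f₀ x) ^ 2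
      ≤ D ^ 2 * (J ^ (-α) + J ^ 2 * (m : ℝ) ^ (-α) * tailSum n m) ^ 2 := by
    rw [← sq_abs, ← mul_pow]
    gcongr
  have hcN : J ^ 2 / N / N ≤ J / N := by
    gcongr
    rw [div_le_iff₀ hN0]
    nlinarith
  set T1 := J / N with hT1
  set T2 := J ^ 2 * tailSum n m / N with hT2
  set T3 := (J ^ (-α) + J ^ 2 * (m : ℝ) ^ (-α) * tailSum n m) ^ 2 with hT3
  have e1 : 2 / N * (3 * J) = 6 * T1 := by rw [hT1]; ring
  have e2 : 2 / N * (J ^ 2 * tailSum n m) = 2 * T2 := by rw [hT2]; ring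
  have p1 : 0 ≤ T1 := by positivity
  have p2 : 0 ≤ T2 := by have := tailSum_nonneg n m; positivity
  have p3 : 0 ≤ T3 := sq_nonneg _
  rw [e1, e2] at hV
  rw [e1] at hq
  have p4 : 0 ≤ D ^ 2 * T1 := by positivity
  have p5 : 0 ≤ D ^ 2 * T2 := by positivity
  linarith

end SecondMoment

end SGPR

theorem theorem3p1
    (α γ : ℝ) (hα : α ∈ Set.Ioc (0 : ℝ) 1) (hγ : γ ∈ Set.Ioc (0 : ℝ) 1)
    (f₀ : unitInterval → ℝ) (hf₀ : SGPR.IsHolder α f₀)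
    (x : unitInterval) (hx : (x : ℝ) ∈ Set.Ioo (0 : ℝ) 1)
    (m : ℕ → ℕ) (hmn : ∀ n, m n ≤ n) (hm : Tendsto m atTop atTop)
    -- eigenvalues and eigenvectors of the kernel matrices
    (μ : (n : ℕ) → Fin n → ℝ) (v : (n : ℕ) → Fin n → Fin n → ℝ)
    (hv : ∀ n, SGPR.IsSortedEigenbasis
      (SGPR.kernelMatrix (SGPR.rbmKernel γ n) (SGPR.designPoint n)) (μ n) (v n))
    -- `Q n y` is the SGPR with the first `m n` eigenvectors as inducing variables, given data `y`
    (Q : (n : ℕ) → (Fin n → ℝ) → Measure (unitInterval → ℝ))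
    (hQ : ∀ n y, SGPR.IsGaussianProcessLaw (Q n y)
      (SGPR.sgprMean 1 (SGPR.rbmKernel γ n) (SGPR.designPoint n)
        (SGPR.eigenWeights (v n) (hmn n)) y)
      (SGPR.sgprCov 1 (SGPR.rbmKernel γ n) (SGPR.designPoint n)
        (SGPR.eigenWeights (v n) (hmn n))))
    -- `post n y` is the full posterior given data `y`
    (post : (n : ℕ) → (Fin n → ℝ) → Measure (unitInterval → ℝ))
    (hpost : ∀ n y, SGPR.IsGaussianProcessLaw (post n y)
      (SGPR.posteriorMean 1 (SGPR.rbmKernel γ n) (SGPR.designPoint n) y)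
      (SGPR.posteriorCov 1 (SGPR.rbmKernel γ n) (SGPR.designPoint n))) :
    SGPR.ContractsAt (fun n ↦ SGPR.dataLaw 1 (SGPR.designPoint n) f₀) Q f₀ x
      (fun n ↦ (n : ℝ) ^ (-(min α γ / (1 + 2 * γ)))
        + (n : ℝ) ^ (2 / (1 + 2 * γ)) * (m n : ℝ) ^ (-(1 + α))
        + (n : ℝ) ^ ((1 / 2 - γ) / (1 + 2 * γ)) * (m n : ℝ) ^ (-(3 / 2) : ℝ)) ∧
    ((fun n : ℕ ↦ (n : ℝ) ^ (1 / (1 + 2 * γ) * ((2 + α) / (1 + α))))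
        =o[atTop] (fun n ↦ (m n : ℝ)) →
      SGPR.ContractsAt (fun n ↦ SGPR.dataLaw 1 (SGPR.designPoint n) f₀) Q f₀ x
        (fun n ↦ (n : ℝ) ^ (-(min α γ / (1 + 2 * γ))))) ∧
    SGPR.ContractsAt (fun n ↦ SGPR.dataLaw 1 (SGPR.designPoint n) f₀) post f₀ x
      (fun n ↦ (n : ℝ) ^ (-(min α γ / (1 + 2 * γ)))) := by
  have hα0 := hα.1
  have hα1 := hα.2
  have hγ0 := hγ.1
  obtain ⟨C, hC0, hC⟩ := hf₀.exists_second_moment_le hα hγ hx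
  have hk : ∀ n, ∀ s t : unitInterval, SGPR.rbmKernel γ n s t
      = ((n : ℝ) + 1 / 2) ^ ((1 - 2 * γ) / (1 + 2 * γ)) * min (s : ℝ) (t : ℝ) := fun _ _ _ ↦ rfl
  have hμ : ∀ n j, 0 < μ n j := fun n ↦ (hv n).eigenvalue_pos (hk n) (by positivity)
  set ρ : ℕ → ℝ := fun n ↦ (n : ℝ) ^ (-(min α γ / (1 + 2 * γ))) with hρ
  set A : ℕ → ℝ := fun n ↦ (n : ℝ) ^ (2 / (1 + 2 * γ)) * (m n : ℝ) ^ (-(1 + α)) with hA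
  have hρ0 : ∀ᶠ n in atTop, 0 < ρ n := by
    filter_upwards [eventually_gt_atTop 0] with n hn
    have : (0 : ℝ) < n := by exact_mod_cast hn
    positivity
  have hA0 : ∀ n, 0 ≤ A n := fun n ↦ by positivity
  -- A rate that dominates `ρ + A` up to a constant is a contraction rate of the SGPR.
  have hsgpr : ∀ (ε : ℕ → ℝ) (D : ℝ), (∀ᶠ n in atTop, 0 < ε n) →
      (∀ᶠ n in atTop, ρ n + A n ≤ D * ε n) →
      SGPR.ContractsAt (fun n ↦ SGPR.dataLaw 1 (SGPR.designPoint n) f₀) Q f₀ x ε := by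
    intro ε D hε hD
    refine SGPR.contractsAt_of_second_moment _ f₀ x Q _ _ hQ
      (fun n ↦ SGPR.meanWeights (μ n) (v n) (m n)
        (SGPR.kernelVec (SGPR.rbmKernel γ n) (SGPR.designPoint n) x))
      (fun n y ↦ ?_) ε (C * 50 * D ^ 2) hε ?_
    · rw [(hv n).sgprMean_eq (hμ n), SGPR.meanWeights_dotProduct]
    filter_upwards [hC, hD, hρ0, hm.eventually_ne_atTop 0, eventually_ne_atTop 0]
      with n hCn hDn hρn hmn0 hn0
    rw [(hv n).sgprCov_self_eq (hμ n)]
    refine (hCn (m n) hmn0 (μ n) (v n) (hv n)).trans ?_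
    have h1 := SGPR.cutoff_rpow_neg_le hα0 hγ0 hn0
    have h2 := SGPR.cutoff_div_le α hγ0 hn0
    have h3 := SGPR.cutoff_sq_le hγ0 hn0
    have hJ := SGPR.one_le_cutoff hγ0 hn0
    have hm1 : (1 : ℝ) ≤ m n := by exact_mod_cast Nat.one_le_iff_ne_zero.mpr hmn0
    have hmn1 : (m n : ℝ) ≤ n + 1 / 2 := by
      have : (m n : ℝ) ≤ n := by exact_mod_cast hmn n
      linarith
    have h4 := SGPR.excess_variance_le hα1 hJ hm1 hmn1
    have h5 := SGPR.tailSum_le hmn0 (hmn n)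
    have h5' := SGPR.tailSum_nonneg n (m n)
    set J := SGPR.cutoff γ n
    have h6 : J ^ 2 * (m n : ℝ) ^ (-(1 + α)) ≤ 4 * A n := by
      simp only [hA]
      rw [← mul_assoc]
      gcongr
    have h7 : J ^ 2 * (m n : ℝ) ^ (-α) * SGPR.tailSum n (m n) ≤ 4 * A n := by
      refine le_trans ?_ h6
      have e : (m n : ℝ) ^ (-(1 + α)) = (m n : ℝ) ^ (-α) * (m n : ℝ)⁻¹ := by
        rw [← Real.rpow_neg_one, ← Real.rpow_add (by linarith)]
        congr 1; ring
      rw [e, ← mul_assoc]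
      gcongr
    have h8 : J ^ 2 * SGPR.tailSum n (m n) / (n + 1 / 2) ≤ ρ n ^ 2 + (4 * A n) ^ 2 := by
      calc _ ≤ J ^ 2 * (m n : ℝ)⁻¹ / (n + 1 / 2) := by gcongr
        _ ≤ _ := h4
        _ ≤ _ := by gcongr
    have h9 : (J ^ (-α) + J ^ 2 * (m n : ℝ) ^ (-α) * SGPR.tailSum n (m n)) ^ 2
        ≤ (ρ n + 4 * A n) ^ 2 := by gcongr
    have hAn := hA0 n
    calc C * _ ≤ C * (ρ n ^ 2 + (ρ n ^ 2 + (4 * A n) ^ 2) + (ρ n + 4 * A n) ^ 2) := by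
          gcongr
      _ ≤ C * (50 * (ρ n + A n) ^ 2) := by
          gcongr
          nlinarith [mul_nonneg hρn.le hAn, sq_nonneg (ρ n), sq_nonneg (A n)]
      _ ≤ C * (50 * (D * ε n) ^ 2) := by gcongr
      _ = _ := by ring
  refine ⟨?_, fun hlarge ↦ ?_, ?_⟩
  -- The third term of the rate only has to be nonnegative.
  · refine hsgpr _ 1 ?_ ?_
    · filter_upwards [hρ0] with n hn
      have h1 := hA0 n
      have h2 : 0 ≤ (n : ℝ) ^ ((1 / 2 - γ) / (1 + 2 * γ)) * (m n : ℝ) ^ (-(3 / 2) : ℝ) := by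
        positivity
      simp only [hρ, hA] at hn h1
      linarith
    · refine Eventually.of_forall fun n ↦ ?_
      have h2 : 0 ≤ (n : ℝ) ^ ((1 / 2 - γ) / (1 + 2 * γ)) * (m n : ℝ) ^ (-(3 / 2) : ℝ) := by
        positivity
      simp only [hρ, hA]
      linarith
  · refine hsgpr _ 2 hρ0 ?_
    filter_upwards [hlarge.bound one_pos, eventually_ne_atTop 0] with n hn hn0
    have hn1 : (1 : ℝ) ≤ n := by exact_mod_cast Nat.one_le_iff_ne_zero.mpr hn0
    have hn' : (0 : ℝ) < n := by linarith
    rw [one_mul, Real.norm_of_nonneg (by positivity), Real.norm_of_nonneg (by positivity)] at hn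
    have h1 : A n ≤ ρ n := by
      simp only [hA, hρ]
      calc (n : ℝ) ^ (2 / (1 + 2 * γ)) * (m n : ℝ) ^ (-(1 + α))
          ≤ (n : ℝ) ^ (2 / (1 + 2 * γ))
              * ((n : ℝ) ^ (1 / (1 + 2 * γ) * ((2 + α) / (1 + α)))) ^ (-(1 + α)) := by
            have : (m n : ℝ) ^ (-(1 + α))
                ≤ ((n : ℝ) ^ (1 / (1 + 2 * γ) * ((2 + α) / (1 + α)))) ^ (-(1 + α)) :=
              Real.rpow_le_rpow_of_nonpos (by positivity) hn (by linarith)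
            gcongr
        _ = (n : ℝ) ^ (-(α / (1 + 2 * γ))) := by
            rw [← Real.rpow_mul hn'.le, ← Real.rpow_add hn']
            congr 1
            field_simp
            ring
        _ ≤ _ := by
            refine Real.rpow_le_rpow_of_exponent_le hn1 ?_
            gcongr
            exact min_le_left _ _
    linarith
  · refine SGPR.contractsAt_of_second_moment _ f₀ x post _ _ hpost
      (fun n ↦ SGPR.meanWeights (μ n) (v n) n
        (SGPR.kernelVec (SGPR.rbmKernel γ n) (SGPR.designPoint n) x))
      (fun n y ↦ ?_) _ (C * 2) hρ0 ?_
    · rw [(hv n).posteriorMean_eq (hμ n) (SGPR.kernelMatrix_transpose (hk n)),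
        SGPR.meanWeights_dotProduct]
    filter_upwards [hC, eventually_ne_atTop 0] with n hCn hn0
    rw [(hv n).posteriorCov_self_eq (hμ n) (SGPR.kernelMatrix_transpose (hk n))]
    refine (hCn n hn0 (μ n) (v n) (hv n)).trans ?_
    have h1 := SGPR.cutoff_rpow_neg_le hα0 hγ0 hn0
    have h2 := SGPR.cutoff_div_le α hγ0 hn0
    have hJ := SGPR.cutoff_pos γ n
    rw [SGPR.tailSum_self, mul_zero, mul_zero, zero_div, add_zero, add_zero]
    calc C * (SGPR.cutoff γ n / (n + 1 / 2) + (SGPR.cutoff γ n ^ (-α)) ^ 2)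
        ≤ C * (ρ n ^ 2 + ρ n ^ 2) := by gcongr
      _ = _ := by ring
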